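/- Let $\mathbf u=2^{-53}$ and let $X\in\mathbb R^{m\times n}$ have full column rank. Write $\kappa_2(X)=\|X\|_2/\sigma_{\min}(X)$, $c=\max_{i,j}|x_{ij}|$, $[X]_g=\max_j\|X_j\|_2$ (the largest Euclidean norm of a column) and $p=[X]_g/\|X\|_2$. Let $X$ be a $T_1$ matrix with parameters $v,t_1,t_2$: there are $v$ dense columns, $0<v<n$, each with at most $t_1$ non-zero elements, and each remaining column has at most $t_2$ non-zero elements, where $0<t_2<t_1\le m$. Put $r=\frac{n\sqrt n}{m\sqrt v}$, $h=\sqrt{2.23+0.34r+0.013r^2}$, $l=\frac{c\sqrt{t_1}}{\|X\|_2}$ and $$j_s=\min\bigl(11(m\mathbf u+(n+1)\mathbf u)(vt_1+nt_2)c^2,\;11(mn\mathbf u+n(n+1)\mathbf u)[X]_g^2\bigr).$$ Let $j_b=\min\bigl(\tfrac1{100n}(vt_1+nt_2)c^2,\tfrac1{100}t_1c^2\bigr)$ and $U=\frac1{4n^2\mathbf u\,hl}$ if $j_s$ equals the first term of the minimum, and $j_b=\frac1{100}[X]_g^2$ and $U=\frac1{4.89\,p\,n^2\mathbf u}$ otherwise.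 Suppose that $X$ satisfies the element-norm condition $c=\sqrt{\beta/m}\,\|X\|_2$ with $\beta\le\frac{mnp^2}{vt_1+nt_2}$, and let $\epsilon=\frac{\beta(vt_1+nt_2)}{m}$. Then: (1) $j_s=11(m\mathbf u+(n+1)\mathbf u)(vt_1+nt_2)c^2$. (2) $\frac{(vt_1+nt_2)c^2}{\|X\|_2^2}=\epsilon$; and under the general settings $mn\mathbf u\le\frac1{64}$, $n(n+1)\mathbf u\le\frac1{64}$, $j_s\le j_b$, $\kappa_2(X)\le U$, the condition $$\kappa_2(X)\le\frac{1}{16\sqrt{11n\epsilon}\,(m\mathbf u+(n+1)\mathbf u)\,h}$$ is sufficient for Shifted CholeskyQR3 with the shift $s=j_s$, in the following sense. The algorithm is: $Y=\mathrm{Cholesky}(X^\top X+sI)$, $W=XY^{-1}$; then $D=\mathrm{Cholesky}(W^\top W)$, $V=WD^{-1}$; then $J=\mathrm{Cholesky}(V^\top V)$, $Q=VJ^{-1}$; and $Z=JD$, $R=ZY$. It is carried out in floating-point arithmetic in the standard model: each operation $+,-,\times,/,\sqrt{\ }$ is performed exactly and then rounded by a function $fl:\mathbb R\to\mathbb R$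 with $|fl(x)-x|\le\mathbf u|x|$ for all $x$. Inner products are summed from left to right, Cholesky factorization is the standard one, and $XY^{-1}$, $WD^{-1}$, $VJ^{-1}$ are computed row by row by substitution. For every such $fl$, the computed quantities satisfy: none of the three Cholesky factorizations breaks down (all pivots are positive); $W$ has full column rank and $8\,\kappa_2(W)\sqrt{mn\mathbf u+n(n+1)\mathbf u}\le1$; and $$\|Q^\top Q-I\|_F\le6(mn\mathbf u+n(n+1)\mathbf u),\qquad\|QR-X\|_F\le(2.19+3.4\,l)\,h\,n^2\mathbf u\,\|X\|_2 .$$ -/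

import Mathlib

open scoped Matrix

noncomputable section

namespace SparseCholQR

/-! ### Norms, singular values and the quantities attached to a sparse matrix -/

/-- The machine precision `2⁻⁵³`. -/
def u : ℝ := ((2 : ℝ) ^ 53)⁻¹

/-- The spectral norm `‖X‖₂`, the operator norm for Euclidean norms. -/
def norm2 {m n : ℕ} (X : Matrix (Fin m) (Fin n) ℝ) : ℝ :=
  ‖(Matrix.toEuclideanLin X).toContinuousLinearMap‖

/-- The Frobenius norm `‖X‖_F`. -/
def normF {m n : ℕ} (X : Matrix (Fin m) (Fin n) ℝ) : ℝ :=
  √(∑ i, ∑ j, X i j ^ 2)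

/-- The `n`-th, that is the smallest, singular value of a matrix with `n ≥ 1` columns
(Mathlib numbers the singular values from `0`, in decreasing order). -/
def sigmaMin {m n : ℕ} (X : Matrix (Fin m) (Fin n) ℝ) : ℝ :=
  (Matrix.toEuclideanLin X).singularValues (n - 1)

/-- The condition number `κ₂(X) = ‖X‖₂ / σ_min(X)`, meaningful for `X` of full column rank. -/
def kappa2 {m n : ℕ} (X : Matrix (Fin m) (Fin n) ℝ) : ℝ :=
  norm2 X / sigmaMin X

/-- `[X]_g`, the largest Euclidean norm of a column of `X`. -/
def gNorm {m n : ℕ} (X : Matrix (Fin m) (Fin n) ℝ) : ℝ :=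
  ⨆ j : Fin n, √(∑ i, X i j ^ 2)

/-- `c = max |x_ij|`. -/
def maxAbs {m n : ℕ} (X : Matrix (Fin m) (Fin n) ℝ) : ℝ :=
  ⨆ ij : Fin m × Fin n, |X ij.1 ij.2|

/-- The number of non-zero elements of the `j`-th column of `X`. -/
def colNnz {m n : ℕ} (X : Matrix (Fin m) (Fin n) ℝ) (j : Fin n) : ℕ :=
  (Finset.univ.filter fun i => X i j ≠ 0).card

/-- `X` is a `T₁` matrix with parameters `v`, `t₁`, `t₂`: there are `v > 0` dense columns with at
most `t₁` non-zero elements each, and every other column has at most `t₂` non-zero elements.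
Of the informal requirements `v ≪ n`, `t₂ ≪ t₁`, `t₁` close to `m`, only the inequalities
`v < n`, `t₂ < t₁`, `t₁ ≤ m` are kept. -/
structure IsT1 {m n : ℕ} (X : Matrix (Fin m) (Fin n) ℝ) (v t₁ t₂ : ℕ) : Prop where
  v_pos : 0 < v
  v_lt : v < n
  t₂_pos : 0 < t₂
  t₂_lt : t₂ < t₁
  t₁_le : t₁ ≤ m
  exists_dense : ∃ D : Finset (Fin n), D.card = v ∧
    (∀ j ∈ D, colNnz X j ≤ t₁) ∧ ∀ j ∉ D, colNnz X j ≤ t₂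

/-- The sparse (alternative) shift `11 (m u + (n+1) u) (v t₁ + n t₂) c²`. -/
def altShift {m n : ℕ} (X : Matrix (Fin m) (Fin n) ℝ) (v t₁ t₂ : ℕ) : ℝ :=
  11 * (m * u + (n + 1) * u) * ((v * t₁ + n * t₂) * maxAbs X ^ 2)

/-- The shift `11 (m n u + n (n+1) u) [X]_g²`. -/
def gShift {m n : ℕ} (X : Matrix (Fin m) (Fin n) ℝ) : ℝ :=
  11 * (m * n * u + n * (n + 1) * u) * gNorm X ^ 2

/-- `j_s`, the minimum of the two shifts. -/
def jS {m n : ℕ} (X : Matrix (Fin m) (Fin n) ℝ) (v t₁ t₂ : ℕ) : ℝ :=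
  min (altShift X v t₁ t₂) (gShift X)

/-- `φ = min ((v t₁ + n t₂) c² / (100 n), t₁ c² / 100)`. -/
def phi {m n : ℕ} (X : Matrix (Fin m) (Fin n) ℝ) (v t₁ t₂ : ℕ) : ℝ :=
  min (1 / (100 * n) * ((v * t₁ + n * t₂) * maxAbs X ^ 2)) (1 / 100 * (t₁ * maxAbs X ^ 2))

/-- `p = [X]_g / ‖X‖₂`. -/
def pRatio {m n : ℕ} (X : Matrix (Fin m) (Fin n) ℝ) : ℝ :=
  gNorm X / norm2 X

/-- `l = c √t₁ / ‖X‖₂`. -/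
def lRatio {m n : ℕ} (X : Matrix (Fin m) (Fin n) ℝ) (t₁ : ℕ) : ℝ :=
  maxAbs X * √t₁ / norm2 X

/-- `r = n √n / (m √v)`. -/
def rRatio (m n v : ℕ) : ℝ := n * √n / (m * √v)

/-- `h = √(2.23 + 0.34 r + 0.013 r²)`. -/
def hFactor (m n v : ℕ) : ℝ :=
  √(2.23 + 0.34 * rRatio m n v + 0.013 * rRatio m n v ^ 2)

open Classical in
/-- `j_b`, the upper bound for the shift. -/
def jB {m n : ℕ} (X : Matrix (Fin m) (Fin n) ℝ) (v t₁ t₂ : ℕ) : ℝ :=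
  if jS X v t₁ t₂ = altShift X v t₁ t₂ then phi X v t₁ t₂ else 1 / 100 * gNorm X ^ 2

open Classical in
/-- `U`, the general upper bound for `κ₂(X)`. -/
def kappaCap {m n : ℕ} (X : Matrix (Fin m) (Fin n) ℝ) (v t₁ t₂ : ℕ) : ℝ :=
  if jS X v t₁ t₂ = altShift X v t₁ t₂ then
    1 / (4 * n ^ 2 * u * hFactor m n v * lRatio X t₁)
  else 1 / (4.89 * pRatio X * n ^ 2 * u)

/-- The general settings for Shifted CholeskyQR3 of a sparse matrix with the shift `s`. -/
structure GeneralSettings {m n : ℕ} (X : Matrix (Fin m) (Fin n) ℝ) (v t₁ t₂ : ℕ) (s : ℝ) :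
    Prop where
  size_mn : m * n * u ≤ 1 / 64
  size_nn : n * (n + 1) * u ≤ 1 / 64
  jS_le : jS X v t₁ t₂ ≤ s
  le_jB : s ≤ jB X v t₁ t₂
  kappa2_le : kappa2 X ≤ kappaCap X v t₁ t₂

/-! ### Floating-point arithmetic and the algorithms

An elementary operation `+`, `-`, `*`, `/`, `√` is performed exactly and then rounded by `fl`. -/

/-- The standard model of floating-point arithmetic (no overflow or underflow): rounding a real
number makes a relative error of at most the machine precision. -/
def IsRounding (fl : ℝ → ℝ) : Prop := ∀ x, |fl x - x| ≤ u * |x|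

/-- The computed sum of `k` numbers, from left to right. -/
def flSum (fl : ℝ → ℝ) : (k : ℕ) → (Fin k → ℝ) → ℝ
  | 0, _ => 0
  | 1, x => x 0
  | k + 2, x => fl (flSum fl (k + 1) (fun i => x i.castSucc) + x (Fin.last (k + 1)))

/-- The computed matrix product. -/
def flMul (fl : ℝ → ℝ) {a b c : ℕ} (A : Matrix (Fin a) (Fin b) ℝ) (B : Matrix (Fin b) (Fin c) ℝ) :
    Matrix (Fin a) (Fin c) ℝ :=
  Matrix.of fun i j => flSum fl b fun k => fl (A i k * B k j)

/-- The computed matrix `G + s I`. -/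
def flAddShift (fl : ℝ → ℝ) {n : ℕ} (G : Matrix (Fin n) (Fin n) ℝ) (s : ℝ) :
    Matrix (Fin n) (Fin n) ℝ :=
  Matrix.of fun i j => if i = j then fl (G i i + s) else G i j

/-- Row `k` of the computed Cholesky factor, from the matrix `S` which is left after the
elimination of the rows before `k`. -/
def flCholRow (fl : ℝ → ℝ) {n : ℕ} (S : Matrix (Fin n) (Fin n) ℝ) (k j : Fin n) : ℝ :=
  if j < k then 0
  else if j = k then fl √(S k k)
  else fl (S k j / fl √(S k k))

/-- The matrix which is left after the first `k` steps of Cholesky factorization of `A`: its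
`(i, j)` element, for `i, j ≥ k`, is the computed `a_ij - r_1i r_1j - ⋯ - r_ki r_kj`. -/
def flCholRest (fl : ℝ → ℝ) {n : ℕ} (A : Matrix (Fin n) (Fin n) ℝ) :
    ℕ → Matrix (Fin n) (Fin n) ℝ
  | 0 => A
  | k + 1 =>
    if hk : k < n then
      Matrix.of fun i j =>
        fl (flCholRest fl A k i j -
          fl (flCholRow fl (flCholRest fl A k) ⟨k, hk⟩ i *
            flCholRow fl (flCholRest fl A k) ⟨k, hk⟩ j))
    else flCholRest fl A k

/-- The computed upper triangular Cholesky factor `R`, `A ≈ Rᵀ R`. -/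
def flCholesky (fl : ℝ → ℝ) {n : ℕ} (A : Matrix (Fin n) (Fin n) ℝ) : Matrix (Fin n) (Fin n) ℝ :=
  Matrix.of fun k j => flCholRow fl (flCholRest fl A k) k j

/-- Cholesky factorization runs to completion: all the computed pivots, of which square roots
are taken, are positive. -/
def CholeskyCompletes (fl : ℝ → ℝ) {n : ℕ} (A : Matrix (Fin n) (Fin n) ℝ) : Prop :=
  ∀ k : Fin n, 0 < flCholRest fl A k k k

/-- The row `x - w_1 y_1 - ⋯ - w_k y_k` which is left after `k` steps of the substitution that
solves `w Y = x` for an upper triangular `Y` with rows `y_i`. -/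
def flSolveRest (fl : ℝ → ℝ) {n : ℕ} (Y : Matrix (Fin n) (Fin n) ℝ) (x : Fin n → ℝ) :
    ℕ → Fin n → ℝ
  | 0 => x
  | k + 1 =>
    if hk : k < n then
      fun j => fl (flSolveRest fl Y x k j -
        fl (fl (flSolveRest fl Y x k ⟨k, hk⟩ / Y ⟨k, hk⟩ ⟨k, hk⟩) * Y ⟨k, hk⟩ j))
    else flSolveRest fl Y x k

/-- The computed `X Y⁻¹`, for an upper triangular `Y`: each row is obtained by substitution. -/
def flSolve (fl : ℝ → ℝ) {m n : ℕ} (X : Matrix (Fin m) (Fin n) ℝ) (Y : Matrix (Fin n) (Fin n) ℝ) :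
    Matrix (Fin m) (Fin n) ℝ :=
  Matrix.of fun i j => fl (flSolveRest fl Y (X i) j j / Y j j)

/-- `[Q, R] = CholeskyQR(X)`. -/
def choleskyQR (fl : ℝ → ℝ) {m n : ℕ} (X : Matrix (Fin m) (Fin n) ℝ) :
    Matrix (Fin m) (Fin n) ℝ × Matrix (Fin n) (Fin n) ℝ :=
  let R := flCholesky fl (flMul fl Xᵀ X)
  (flSolve fl X R, R)

/-- `[Q, R] = CholeskyQR2(X)`. -/
def choleskyQR2 (fl : ℝ → ℝ) {m n : ℕ} (X : Matrix (Fin m) (Fin n) ℝ) :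
    Matrix (Fin m) (Fin n) ℝ × Matrix (Fin n) (Fin n) ℝ :=
  let WY := choleskyQR fl X
  let QZ := choleskyQR fl WY.1
  (QZ.1, flMul fl QZ.2 WY.2)

/-- `[Q, R] = SCholeskyQR(X)` with the shift `s`. -/
def sCholeskyQR (fl : ℝ → ℝ) (s : ℝ) {m n : ℕ} (X : Matrix (Fin m) (Fin n) ℝ) :
    Matrix (Fin m) (Fin n) ℝ × Matrix (Fin n) (Fin n) ℝ :=
  let R := flCholesky fl (flAddShift fl (flMul fl Xᵀ X) s)
  (flSolve fl X R, R)

/-- `[Q, R] = SCholeskyQR3(X)` with the shift `s`. -/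
def sCholeskyQR3 (fl : ℝ → ℝ) (s : ℝ) {m n : ℕ} (X : Matrix (Fin m) (Fin n) ℝ) :
    Matrix (Fin m) (Fin n) ℝ × Matrix (Fin n) (Fin n) ℝ :=
  let WY := sCholeskyQR fl s X
  let QZ := choleskyQR2 fl WY.1
  (QZ.1, flMul fl QZ.2 WY.2)

/-- None of the three Cholesky factorizations in `SCholeskyQR3(X)` breaks down. -/
def SCholeskyQR3Completes (fl : ℝ → ℝ) (s : ℝ) {m n : ℕ} (X : Matrix (Fin m) (Fin n) ℝ) : Prop :=
  let W := (sCholeskyQR fl s X).1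
  let V := (choleskyQR fl W).1
  CholeskyCompletes fl (flAddShift fl (flMul fl Xᵀ X) s) ∧
    CholeskyCompletes fl (flMul fl Wᵀ W) ∧
    CholeskyCompletes fl (flMul fl Vᵀ V)

/-- Shifted CholeskyQR3 with the shift `s` works for the `T₁` matrix `X`: it does not break down;
the first computed factor `W` has full column rank and satisfies the condition of CholeskyQR2,
`8 κ₂(W) √(m n u + n (n+1) u) ≤ 1`; and the computed `Q`, `R` satisfy the orthogonality bound
and the residual bound of the algorithm. -/
structure SCholeskyQR3Works (fl : ℝ → ℝ) (s : ℝ) {m n : ℕ} (X : Matrix (Fin m) (Fin n) ℝ)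
    (v t₁ : ℕ) : Prop where
  completes : SCholeskyQR3Completes fl s X
  rank_W : (sCholeskyQR fl s X).1.rank = n
  kappa2_W : 8 * kappa2 (sCholeskyQR fl s X).1 * √(m * n * u + n * (n + 1) * u) ≤ 1
  orthogonality : normF ((sCholeskyQR3 fl s X).1ᵀ * (sCholeskyQR3 fl s X).1 - 1) ≤
    6 * (m * n * u + n * (n + 1) * u)
  residual : normF ((sCholeskyQR3 fl s X).1 * (sCholeskyQR3 fl s X).2 - X) ≤
    (2.19 + 3.4 * lRatio X t₁) * hFactor m n v * n ^ 2 * u * norm2 X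

end SparseCholQR

end

/-! Write `a = (m + n + 1) u`, `θ = n a` and `F = (v t₁ + n t₂) c²`. Counting non-zero entries gives
`‖X‖_F² ≤ F`. The element-norm condition says `F = ε ‖X‖₂²`, and the bound on `β` turns into `F ≤ n
[X]_g²`; this decides the minimum in `j_s`, so `s = 11 a F`.

The shift dominates all rounding. The errors of the Gram product, of adding the shift and of the
Cholesky factorization sum to at most `s / 8` in the Frobenius norm, whence `‖Yx‖² = ‖Xx‖² + (1 ±
1/8) s ‖x‖²` (`vn_cholesky_sq`). Therefore `X Y⁻¹` has norm at most 1 and smallest singular value at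
least `√(σ² / (σ² + 9s/8))`, where `σ = σ_min(X)`. The error of the substitution perturbs this only
slightly (`norm2_solve_le`, `solve_lower`).

Squaring the condition on `κ₂(X)` gives `570 θ s ≤ σ²`, while `s ≤ j_b` gives `θ ≤ 1/1100`. Together
they yield `θ ≤ σ_W² / 200` for the lower bound `σ_W` of the singular values of `W` (`theta_le`). An
unshifted CholeskyQR step then brings all singular values into `[0.99, 1.006]`
(`choleskyQR_bounds`), and another one makes the loss of orthogonality `O(θ)`
(`choleskyQR_orthogonality`). The residual is a telescoping sum of five backward errors
(`residual_decomposition`).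

That no factorization breaks down is `choleskyCompletes_of_lower_bound`: a non-positive pivot would
produce a singular `PᵀP` within relative error `gam (n + 1)` of a leading block of a matrix whose
smallest eigenvalue is too large for that. -/

namespace SparseCholQR

open Finset

variable {m n k : ℕ}

/-! ### Euclidean norm of vectors -/

/-- The Euclidean norm of a vector. -/
noncomputable def vn (x : Fin n → ℝ) : ℝ := ‖WithLp.toLp 2 x‖

theorem vn_nonneg (x : Fin n → ℝ) : 0 ≤ vn x := norm_nonneg _

theorem vn_sq (x : Fin n → ℝ) : vn x ^ 2 = ∑ i, x i ^ 2 := by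
  simp [vn, EuclideanSpace.norm_sq_eq]

theorem vn_sq_dot (x : Fin n → ℝ) : vn x ^ 2 = x ⬝ᵥ x := by
  rw [vn_sq]; simp [dotProduct, pow_two]

theorem vn_add_le (x y : Fin n → ℝ) : vn (x + y) ≤ vn x + vn y := by
  simpa [vn] using norm_add_le (WithLp.toLp 2 x) (WithLp.toLp 2 y)

theorem vn_le_add_sub (x y : Fin n → ℝ) : vn x ≤ vn (x + y) + vn y := by
  have := norm_sub_le (WithLp.toLp 2 (x + y)) (WithLp.toLp 2 y)
  simpa [vn, ← WithLp.toLp_sub] using this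

theorem dot_le_vn_mul (x y : Fin n → ℝ) : |x ⬝ᵥ y| ≤ vn x * vn y := by
  have := abs_real_inner_le_norm (WithLp.toLp 2 y) (WithLp.toLp 2 x)
  simp only [EuclideanSpace.inner_eq_star_dotProduct] at this
  simpa [vn, mul_comm] using this

theorem vn_pos {x : Fin n → ℝ} (hx : x ≠ 0) : 0 < vn x := by
  simpa [vn] using hx

theorem vn_single (j : Fin n) : vn (Pi.single j (1 : ℝ)) = 1 := by
  have : vn (Pi.single j (1 : ℝ)) = ‖EuclideanSpace.single j (1 : ℝ)‖ := rfl
  rw [this]; simp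

/-! ### The spectral norm -/

theorem norm2_nonneg (A : Matrix (Fin m) (Fin n) ℝ) : 0 ≤ norm2 A := norm_nonneg _

theorem vn_mulVec_le (A : Matrix (Fin m) (Fin n) ℝ) (x : Fin n → ℝ) :
    vn (A *ᵥ x) ≤ norm2 A * vn x :=
  (Matrix.toEuclideanLin A).toContinuousLinearMap.le_opNorm (WithLp.toLp 2 x)

theorem norm2_le {A : Matrix (Fin m) (Fin n) ℝ} {b : ℝ} (hb : 0 ≤ b)
    (h : ∀ x, vn (A *ᵥ x) ≤ b * vn x) : norm2 A ≤ b :=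
  ContinuousLinearMap.opNorm_le_bound _ hb fun x => h x.ofLp

theorem norm2_transpose (A : Matrix (Fin m) (Fin n) ℝ) : norm2 Aᵀ = norm2 A := by
  have := Matrix.l2_opNorm_conjTranspose A
  simp only [Matrix.conjTranspose_eq_transpose_of_trivial] at this
  -- `norm2` unfolds to the `L²` operator norm of matrices, so the C⋆-identity for that norm
  -- applies.
  exact this

/-! ### The Frobenius norm -/

theorem normF_nonneg (A : Matrix (Fin m) (Fin n) ℝ) : 0 ≤ normF A := Real.sqrt_nonneg _

theorem normF_sq (A : Matrix (Fin m) (Fin n) ℝ) : normF A ^ 2 = ∑ i, ∑ j, A i j ^ 2 :=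
  Real.sq_sqrt (by positivity)

theorem normF_transpose (A : Matrix (Fin m) (Fin n) ℝ) : normF Aᵀ = normF A := by
  simp only [normF, Matrix.transpose_apply]
  rw [sum_comm]

theorem normF_neg (A : Matrix (Fin m) (Fin n) ℝ) : normF (-A) = normF A := by
  simp [normF]

theorem normF_eq_norm (A : Matrix (Fin m) (Fin n) ℝ) :
    normF A = ‖(WithLp.toLp 2 fun ij : Fin m × Fin n => A ij.1 ij.2 :
      EuclideanSpace ℝ (Fin m × Fin n))‖ := by
  simp [EuclideanSpace.norm_eq, normF, Fintype.sum_prod_type]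

theorem normF_add_le (A B : Matrix (Fin m) (Fin n) ℝ) : normF (A + B) ≤ normF A + normF B := by
  simp only [normF_eq_norm]
  exact norm_add_le (WithLp.toLp 2 fun ij : Fin m × Fin n => A ij.1 ij.2)
    (WithLp.toLp 2 fun ij : Fin m × Fin n => B ij.1 ij.2)

theorem normF_mono {A B : Matrix (Fin m) (Fin n) ℝ} (h : ∀ i j, |A i j| ≤ B i j) :
    normF A ≤ normF B := by
  refine Real.sqrt_le_sqrt (sum_le_sum fun i _ => sum_le_sum fun j _ => ?_)
  exact sq_le_sq.2 ((h i j).trans (le_abs_self _))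

theorem normF_smul {c : ℝ} (hc : 0 ≤ c) (A : Matrix (Fin m) (Fin n) ℝ) :
    normF (c • A) = c * normF A := by
  simp only [normF, Matrix.smul_apply, smul_eq_mul, mul_pow, ← mul_sum]
  rw [Real.sqrt_mul (by positivity), Real.sqrt_sq hc]

/-- The matrix of absolute values. -/
noncomputable def absM (A : Matrix (Fin m) (Fin n) ℝ) : Matrix (Fin m) (Fin n) ℝ := A.map fun x => |x|

theorem normF_absM (A : Matrix (Fin m) (Fin n) ℝ) : normF (absM A) = normF A := by
  simp [normF, absM]

theorem normF_sq_eq_sum_vn (A : Matrix (Fin m) (Fin n) ℝ) :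
    normF A ^ 2 = ∑ j, vn (A.col j) ^ 2 := by
  simp_rw [normF_sq, vn_sq]
  rw [sum_comm]
  rfl

/-- Column by column. Keeping the spectral norm on one factor means that a nearly orthonormal factor
costs a constant instead of `√n`. -/
theorem normF_mul_le (A : Matrix (Fin m) (Fin n) ℝ) (B : Matrix (Fin n) (Fin k) ℝ) :
    normF (A * B) ≤ norm2 A * normF B := by
  refine le_of_sq_le_sq ?_ (mul_nonneg (norm2_nonneg _) (normF_nonneg _))
  rw [mul_pow, normF_sq_eq_sum_vn, normF_sq_eq_sum_vn, mul_sum]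
  refine sum_le_sum fun j _ => ?_
  rw [← mul_pow]
  have : (A * B).col j = A *ᵥ B.col j := by ext i; simp [Matrix.mul_apply, Matrix.mulVec, dotProduct]
  rw [this]
  exact pow_le_pow_left₀ (vn_nonneg _) (vn_mulVec_le _ _) 2

theorem normF_mul_le' (A : Matrix (Fin m) (Fin n) ℝ) (B : Matrix (Fin n) (Fin k) ℝ) :
    normF (A * B) ≤ normF A * norm2 B := by
  rw [← normF_transpose, Matrix.transpose_mul, ← normF_transpose A, ← norm2_transpose B, mul_comm]
  exact normF_mul_le _ _

theorem normF_le_sqrt_mul (A : Matrix (Fin m) (Fin n) ℝ) : normF A ≤ √n * norm2 A := by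
  refine le_of_sq_le_sq ?_ (mul_nonneg (Real.sqrt_nonneg _) (norm2_nonneg _))
  rw [mul_pow, normF_sq_eq_sum_vn, Real.sq_sqrt (by positivity)]
  calc ∑ j, vn (A.col j) ^ 2 ≤ ∑ j : Fin n, norm2 A ^ 2 := by
        refine sum_le_sum fun j _ => ?_
        have := vn_mulVec_le A (Pi.single j 1)
        rw [vn_single, Matrix.mulVec_single_one, mul_one] at this
        exact pow_le_pow_left₀ (vn_nonneg _) this 2
    _ = n * norm2 A ^ 2 := by simp

theorem vn_mulVec_le_normF (A : Matrix (Fin m) (Fin n) ℝ) (x : Fin n → ℝ) :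
    vn (A *ᵥ x) ≤ normF A * vn x := by
  refine le_of_sq_le_sq ?_ (mul_nonneg (normF_nonneg _) (vn_nonneg _))
  rw [mul_pow, vn_sq, vn_sq, normF_sq, sum_mul]
  exact sum_le_sum fun i _ => sum_mul_sq_le_sq_mul_sq univ (A i) x

theorem norm2_le_normF (A : Matrix (Fin m) (Fin n) ℝ) : norm2 A ≤ normF A :=
  norm2_le (normF_nonneg _) (vn_mulVec_le_normF A)

theorem normF_mul_le_normF_mul_normF (A : Matrix (Fin m) (Fin n) ℝ)
    (B : Matrix (Fin n) (Fin k) ℝ) : normF (A * B) ≤ normF A * normF B :=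
  (normF_mul_le A B).trans (mul_le_mul_of_nonneg_right (norm2_le_normF A) (normF_nonneg _))

theorem abs_dot_mulVec_le (E : Matrix (Fin n) (Fin n) ℝ) (x : Fin n → ℝ) :
    |x ⬝ᵥ (E *ᵥ x)| ≤ normF E * vn x ^ 2 := by
  refine (dot_le_vn_mul _ _).trans ?_
  have := mul_le_mul_of_nonneg_left (vn_mulVec_le_normF E x) (vn_nonneg x)
  linarith

theorem vn_mulVec_sq (A : Matrix (Fin m) (Fin n) ℝ) (x : Fin n → ℝ) :
    vn (A *ᵥ x) ^ 2 = x ⬝ᵥ ((Aᵀ * A) *ᵥ x) := by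
  rw [vn_sq_dot, ← Matrix.mulVec_mulVec, Matrix.dotProduct_mulVec x, Matrix.vecMul_transpose]

/-- Entrywise bounds by a product of absolute values give Frobenius bounds. -/
theorem normF_le_of_abs_le {l : ℕ} {E : Matrix (Fin m) (Fin n) ℝ} {A : Matrix (Fin m) (Fin l) ℝ}
    {B : Matrix (Fin l) (Fin n) ℝ} {g : ℝ} (hg : 0 ≤ g)
    (h : ∀ i j, |E i j| ≤ g * ∑ k, |A i k * B k j|) : normF E ≤ g * (normF A * normF B) := by
  have h1 : normF E ≤ normF (g • (absM A * absM B)) := by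
    refine normF_mono fun i j => (h i j).trans_eq ?_
    simp [absM, Matrix.mul_apply, abs_mul]
  rw [normF_smul hg] at h1
  refine h1.trans (mul_le_mul_of_nonneg_left ?_ hg)
  simpa [normF_absM] using normF_mul_le_normF_mul_normF (absM A) (absM B)

/-! ### The smallest singular value -/

/-- In an orthonormal eigenbasis of `AᵀA`, `‖Ax‖²` is the sum of the squared coordinates weighted by
the eigenvalues, the least of which is the last one, `sigmaMin A ^ 2`. -/
theorem sigmaMin_mul_vn_le (hn : 0 < n) (A : Matrix (Fin m) (Fin n) ℝ) (x : Fin n → ℝ) :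
    sigmaMin A * vn x ≤ vn (A *ᵥ x) := by
  set T := Matrix.toEuclideanLin A with hT
  have hfr : Module.finrank ℝ (EuclideanSpace ℝ (Fin n)) = n := by simp
  set hS := T.isSymmetric_adjoint_comp_self
  set b := hS.eigenvectorBasis hfr
  set y : EuclideanSpace ℝ (Fin n) := WithLp.toLp 2 x
  have hT2 : ‖T y‖ ^ 2 = ∑ i, hS.eigenvalues hfr i * ‖inner ℝ (b i) y‖ ^ 2 := by
    have h1 : ‖T y‖ ^ 2 = inner ℝ ((LinearMap.adjoint T ∘ₗ T) y) y := by
      rw [LinearMap.comp_apply, LinearMap.adjoint_inner_left, real_inner_self_eq_norm_sq]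
    rw [h1, ← b.sum_inner_mul_inner]
    refine sum_congr rfl fun i _ => ?_
    have : inner ℝ ((LinearMap.adjoint T ∘ₗ T) y) (b i) =
        hS.eigenvalues hfr i * inner ℝ (b i) y := by
      rw [hS y (b i), hS.apply_eigenvectorBasis hfr i]
      rw [real_inner_comm]; simp [inner_smul_left, b]
    rw [this, Real.norm_eq_abs, sq_abs]; ring
  have hmin : sigmaMin A ^ 2 = hS.eigenvalues hfr ⟨n - 1, by omega⟩ :=
    T.sq_singularValues_of_lt hfr (by omega)
  refine le_of_sq_le_sq ?_ (vn_nonneg _)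
  have e : vn (A *ᵥ x) = ‖T y‖ := rfl
  have e2 : vn x = ‖y‖ := rfl
  rw [e, e2, hT2, mul_pow, ← b.sum_sq_norm_inner_right y, mul_sum, hmin]
  refine sum_le_sum fun i _ => mul_le_mul_of_nonneg_right ?_ (by positivity)
  exact hS.eigenvalues_antitone hfr (Fin.mk_le_mk.2 (by omega) : i ≤ ⟨n - 1, by omega⟩)

/-- Test the hypothesis on a unit eigenvector of `AᵀA` for the last eigenvalue. -/
theorem le_sigmaMin (hn : 0 < n) {A : Matrix (Fin m) (Fin n) ℝ} {b : ℝ}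
    (h : ∀ x, b * vn x ≤ vn (A *ᵥ x)) : b ≤ sigmaMin A := by
  set T := Matrix.toEuclideanLin A with hT
  have hfr : Module.finrank ℝ (EuclideanSpace ℝ (Fin n)) = n := by simp
  set hS := T.isSymmetric_adjoint_comp_self
  set i : Fin n := ⟨n - 1, by omega⟩
  set w := hS.eigenvectorBasis hfr i
  have hw : ‖w‖ = 1 := (hS.eigenvectorBasis hfr).orthonormal.1 i
  have hmin : sigmaMin A ^ 2 = hS.eigenvalues hfr i := T.sq_singularValues_of_lt hfr (by omega)
  have h1 : ‖T w‖ ^ 2 = sigmaMin A ^ 2 := by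
    have h1 : ‖T w‖ ^ 2 = inner ℝ ((LinearMap.adjoint T ∘ₗ T) w) w := by
      rw [LinearMap.comp_apply, LinearMap.adjoint_inner_left, real_inner_self_eq_norm_sq]
    rw [h1, hS.apply_eigenvectorBasis hfr i, inner_smul_left, real_inner_self_eq_norm_sq, hw, hmin]
    simp
  have h2 := h w.ofLp
  have e : vn (A *ᵥ w.ofLp) = ‖T w‖ := rfl
  have e2 : vn w.ofLp = ‖w‖ := rfl
  rw [e, e2, hw, mul_one] at h2
  have h0 : 0 ≤ sigmaMin A := LinearMap.singularValues_nonneg _ _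
  rwa [(sq_eq_sq₀ (norm_nonneg _) h0).1 h1] at h2

theorem sigmaMin_pos (hn : 0 < n) {A : Matrix (Fin m) (Fin n) ℝ} (hA : A.rank = n) :
    0 < sigmaMin A := by
  refine (LinearMap.singularValues_pos_iff_lt_finrank_range _).2 ?_
  have : Module.finrank ℝ (Matrix.toEuclideanLin A).range = A.rank :=
    (Matrix.rank_eq_finrank_range_toLin A (PiLp.basisFun 2 ℝ _) (PiLp.basisFun 2 ℝ _)).symm
  omega

theorem mulVecLin_injective_of_lower_bound {A : Matrix (Fin m) (Fin n) ℝ} {b : ℝ} (hb : 0 < b)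
    (h : ∀ x, b * vn x ≤ vn (A *ᵥ x)) : Function.Injective A.mulVecLin := by
  rw [← LinearMap.ker_eq_bot, LinearMap.ker_eq_bot']
  intro x hx
  by_contra hne
  have h1 := h x
  rw [Matrix.mulVecLin_apply] at hx
  rw [hx] at h1
  have : vn (0 : Fin m → ℝ) = 0 := by simp [vn]
  have := mul_pos hb (vn_pos hne)
  linarith

theorem rank_eq_of_lower_bound {A : Matrix (Fin m) (Fin n) ℝ} {b : ℝ} (hb : 0 < b)
    (h : ∀ x, b * vn x ≤ vn (A *ᵥ x)) : A.rank = n := by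
  rw [Matrix.rank, LinearMap.finrank_range_of_inj (mulVecLin_injective_of_lower_bound hb h)]
  simp

theorem exists_mulVec_eq_of_lower_bound {A : Matrix (Fin n) (Fin n) ℝ} {b : ℝ} (hb : 0 < b)
    (h : ∀ x, b * vn x ≤ vn (A *ᵥ x)) (z : Fin n → ℝ) : ∃ x, A *ᵥ x = z :=
  LinearMap.injective_iff_surjective.1 (mulVecLin_injective_of_lower_bound hb h) z

/-! ### Accumulated rounding errors -/

theorem u_pos : 0 < u := by unfold u; positivity

theorem u_le : u ≤ 1 / 10 ^ 15 := by unfold u; norm_num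

/-- The bound `(1 + u / (1 - u)) ^ k - 1` for the effect of `k` rounding errors. -/
noncomputable def gam (k : ℕ) : ℝ := (1 + u / (1 - u)) ^ k - 1

theorem u_le_div : u ≤ u / (1 - u) := by
  have := u_pos; have := u_le
  rw [le_div_iff₀ (by linarith)]; nlinarith

theorem gam_zero : gam 0 = 0 := by simp [gam]

theorem gam_one : gam 1 = u / (1 - u) := by simp [gam]

theorem u_le_gam_one : u ≤ gam 1 := gam_one ▸ u_le_div

theorem one_add_gam_add (j k : ℕ) : 1 + gam (j + k) = (1 + gam j) * (1 + gam k) := by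
  simp [gam, pow_add]

theorem gam_mono {j k : ℕ} (h : j ≤ k) : gam j ≤ gam k := by
  have h1 := u_le_div
  have h2 := u_pos
  exact sub_le_sub_right (pow_le_pow_right₀ (by linarith) h) 1

theorem gam_nonneg (k : ℕ) : 0 ≤ gam k := gam_zero ▸ gam_mono (Nat.zero_le k)

/-- Since `(1 + x)^k ≤ exp (k x)`, the quadratic remainder of the exponential gives `gam k ≤ t + t²`
with `t = k u / (1 - u)`; for `k u ≤ 1/2000` this is within a factor 1.001 of `k u`. -/
theorem gam_le {k : ℕ} (h : k * u ≤ 1 / 2000) : gam k ≤ 1.001 * (k * u) := by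
  have h1 := u_pos
  have h2 := u_le
  have hk : 0 ≤ k * u := by positivity
  set t := k * (u / (1 - u)) with ht
  have hu : u / (1 - u) ≤ 1.0001 * u := by
    rw [div_le_iff₀ (by linarith)]; nlinarith
  have ht1 : t ≤ 1.0001 * (k * u) := by
    have := mul_le_mul_of_nonneg_left hu (Nat.cast_nonneg (α := ℝ) k)
    linarith
  have ht0 : 0 ≤ t := mul_nonneg (Nat.cast_nonneg _) (div_nonneg h1.le (by linarith))
  have h3 : gam k ≤ Real.exp t - 1 := by
    refine sub_le_sub_right ?_ 1
    rw [ht, Real.exp_nat_mul]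
    refine pow_le_pow_left₀ ?_ ?_ _
    · linarith [u_le_div]
    · linarith [Real.add_one_le_exp (u / (1 - u))]
  have h4 := Real.abs_exp_sub_one_sub_id_le (x := t) (by rw [abs_of_nonneg ht0]; linarith)
  have h5 := (abs_le.1 h4).2
  nlinarith

section Rounding

variable {fl : ℝ → ℝ}

theorem IsRounding.zero (hfl : IsRounding fl) : fl 0 = 0 := by
  have := hfl 0
  simpa using this

/-- Backward error analysis measures errors against computed quantities. Passing from `|x|` to `|fl
x|` costs a factor `1 / (1 - u)`, which is why `gam` is built from `u / (1 - u)`. -/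
theorem IsRounding.abs_sub_le (hfl : IsRounding fl) (x : ℝ) : |fl x - x| ≤ gam 1 * |fl x| := by
  have h1 := hfl x
  have h2 := u_le
  have h3 := u_pos
  have h4 : |x| ≤ |fl x| + |fl x - x| := by
    have := abs_sub_abs_le_abs_sub x (fl x)
    rw [abs_sub_comm] at this
    linarith
  have h5 : |x| ≤ |fl x| / (1 - u) := by
    rw [le_div_iff₀ (by linarith)]; linarith
  rw [gam_one, div_mul_eq_mul_div, mul_div_assoc]
  exact h1.trans (mul_le_mul_of_nonneg_left h5 h3.le)

/-- A summand meets one rounding as a product and at most `k - 1` as part of a partial sum, hence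
`gam k`. In the induction the last product meets only two roundings, which `gam (k + 2)` covers. -/
theorem abs_flSum_sub_le (hfl : IsRounding fl) : ∀ (k : ℕ) (p : Fin k → ℝ),
    |flSum fl k (fun i => fl (p i)) - ∑ i, p i| ≤ gam k * ∑ i, |p i|
  | 0, p => by simp [flSum]
  | 1, p => by
    simp only [flSum, univ_unique, Fin.default_eq_zero, sum_singleton]
    exact (hfl _).trans (mul_le_mul_of_nonneg_right u_le_gam_one (abs_nonneg _))
  | k + 2, p => by
    have ih := abs_flSum_sub_le hfl (k + 1) (fun i => p i.castSucc)
    rw [flSum, Fin.sum_univ_castSucc, Fin.sum_univ_castSucc (fun i => |p i|)]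
    set s := flSum fl (k + 1) (fun i => fl (p i.castSucc))
    set S := ∑ i : Fin (k + 1), p i.castSucc
    set T := ∑ i : Fin (k + 1), |p i.castSucc|
    set q := p (Fin.last (k + 1))
    have hu := u_pos
    have hST : |S| ≤ T := abs_sum_le_sum_abs _ _
    have h1 := hfl (s + fl q)
    have h2 := hfl q
    have h3 : |s + fl q| ≤ |S| + |s - S| + |q| + |fl q - q| := by
      calc |s + fl q| = |S + (s - S) + q + (fl q - q)| := by congr 1; ring
        _ ≤ _ := by
          refine (abs_add_le _ _).trans (add_le_add ((abs_add_le _ _).trans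
            (add_le_add (abs_add_le _ _) le_rfl)) le_rfl)
    have h4 : |fl (s + fl q) - (S + q)| ≤ |fl (s + fl q) - (s + fl q)| + |s - S| + |fl q - q| := by
      calc |fl (s + fl q) - (S + q)| = |fl (s + fl q) - (s + fl q) + (s - S) + (fl q - q)| := by
            congr 1; ring
        _ ≤ _ := (abs_add_le _ _).trans (add_le_add (abs_add_le _ _) le_rfl)
    have hg : gam (k + 2) = gam (k + 1) * (1 + gam 1) + gam 1 := by
      have := one_add_gam_add (k + 1) 1
      linarith
    have hg1 : gam 1 ≤ gam (k + 1) := gam_mono (by omega)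
    have hg2 := u_le_gam_one
    have hT : 0 ≤ T := (abs_nonneg _).trans hST
    have hq := abs_nonneg q
    have h5 : u * |s + fl q| ≤ u * (T + gam (k + 1) * T + |q| + u * |q|) :=
      mul_le_mul_of_nonneg_left (by linarith) hu.le
    have h6 : u * T ≤ gam 1 * T := mul_le_mul_of_nonneg_right hg2 hT
    have h7 : u * (gam (k + 1) * T) ≤ gam 1 * (gam (k + 1) * T) :=
      mul_le_mul_of_nonneg_right hg2 (mul_nonneg (gam_nonneg _) hT)
    have h8 : u * |q| ≤ gam 1 * |q| := mul_le_mul_of_nonneg_right hg2 hq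
    have h9 : u * |q| ≤ gam (k + 1) * |q| := mul_le_mul_of_nonneg_right (hg2.trans hg1) hq
    have h10 : u * (u * |q|) ≤ gam 1 * (gam (k + 1) * |q|) :=
      mul_le_mul hg2 h9 (by positivity) (gam_nonneg _)
    rw [hg]
    nlinarith

theorem abs_flMul_sub_le (hfl : IsRounding fl) (A : Matrix (Fin m) (Fin k) ℝ)
    (B : Matrix (Fin k) (Fin n) ℝ) (i : Fin m) (j : Fin n) :
    |(flMul fl A B - A * B) i j| ≤ gam k * ∑ l, |A i l * B l j| := by
  simpa [flMul, Matrix.mul_apply] using abs_flSum_sub_le hfl k fun l => A i l * B l j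

theorem normF_flMul_sub_le (hfl : IsRounding fl) (A : Matrix (Fin m) (Fin k) ℝ)
    (B : Matrix (Fin k) (Fin n) ℝ) :
    normF (flMul fl A B - A * B) ≤ gam k * (normF A * normF B) :=
  normF_le_of_abs_le (gam_nonneg _) (abs_flMul_sub_le hfl A B)

/-- The error of a computed difference `ρ₀ - b₀ - ⋯ - b_{K-1}`, relative to the summands and the
computed result. -/
theorem abs_chain_le (hfl : IsRounding fl) {ρ b : ℕ → ℝ} {K : ℕ}
    (h : ∀ k < K, ρ (k + 1) = fl (ρ k - fl (b k))) :
    |ρ 0 - ∑ k ∈ range K, b k - ρ K| ≤ gam K * (∑ k ∈ range K, |b k| + |ρ K|) := by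
  induction K with
  | zero => simp [gam_zero]
  | succ K ih =>
    have ih := ih fun k hk => h k (by omega)
    rw [sum_range_succ, sum_range_succ]
    have hK := h K (by omega)
    set B := ∑ k ∈ range K, b k
    set T := ∑ k ∈ range K, |b k|
    have h1 := hfl.abs_sub_le (ρ K - fl (b K))
    rw [← hK] at h1
    have h2 := hfl (b K)
    have h2' := h2.trans (mul_le_mul_of_nonneg_right u_le_gam_one (abs_nonneg _))
    have h3 : |ρ 0 - (B + b K) - ρ (K + 1)| ≤
        |ρ 0 - B - ρ K| + |ρ (K + 1) - (ρ K - fl (b K))| + |fl (b K) - b K| := by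
      calc |ρ 0 - (B + b K) - ρ (K + 1)| =
          |(ρ 0 - B - ρ K) - (ρ (K + 1) - (ρ K - fl (b K))) + (fl (b K) - b K)| := by
            congr 1; ring
        _ ≤ _ := (abs_add_le _ _).trans (add_le_add (abs_sub _ _) le_rfl)
    have h4 : |ρ K| ≤ |ρ (K + 1)| + |ρ (K + 1) - (ρ K - fl (b K))| + |b K| + |fl (b K) - b K| := by
      calc |ρ K| = |ρ (K + 1) - (ρ (K + 1) - (ρ K - fl (b K))) + b K + (fl (b K) - b K)| := by
            congr 1; ring
        _ ≤ _ := (abs_add_le _ _).trans (add_le_add ((abs_add_le _ _).trans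
            (add_le_add (abs_sub _ _) le_rfl)) le_rfl)
    have hg : gam (K + 1) = gam K * (1 + gam 1) + gam 1 := by
      have := one_add_gam_add K 1
      linarith
    have hT : 0 ≤ T := sum_nonneg fun _ _ => abs_nonneg _
    have h5 := mul_le_mul_of_nonneg_left h4 (gam_nonneg K)
    have h6 := mul_nonneg (mul_nonneg (gam_nonneg K) (gam_nonneg 1)) hT
    have h7 := mul_nonneg (gam_nonneg 1) hT
    have h8 := mul_le_mul_of_nonneg_left h1 (gam_nonneg K)
    have h9 := mul_le_mul_of_nonneg_left h2' (gam_nonneg K)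
    rw [hg]
    linarith

/-- Here `c` is the exact product of the computed factors that stands for the remainder `ρ K`, and
`q` counts the roundings between them: 1 for a division, 2 for the square of a rounded square root.
-/
theorem abs_chain_end_le (hfl : IsRounding fl) {ρ b : ℕ → ℝ} {K q : ℕ} {c : ℝ}
    (h : ∀ k < K, ρ (k + 1) = fl (ρ k - fl (b k))) (hc : |ρ K - c| ≤ gam q * |c|) :
    |ρ 0 - ∑ k ∈ range K, b k - c| ≤ gam (K + q) * (∑ k ∈ range K, |b k| + |c|) := by
  have h1 := abs_chain_le hfl h
  set B := ∑ k ∈ range K, b k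
  set T := ∑ k ∈ range K, |b k|
  have h2 : |ρ 0 - B - c| ≤ |ρ 0 - B - ρ K| + |ρ K - c| := abs_sub_le _ _ _
  have h3 : |ρ K| ≤ |c| + |ρ K - c| := by
    have := abs_add_le c (ρ K - c)
    rwa [add_sub_cancel] at this
  have hg : gam (K + q) = gam K * (1 + gam q) + gam q := by
    have := one_add_gam_add K q
    linarith
  have hT : 0 ≤ T := sum_nonneg fun _ _ => abs_nonneg _
  have h5 := mul_le_mul_of_nonneg_left h3 (gam_nonneg K)
  have h6 := mul_nonneg (mul_nonneg (gam_nonneg K) (gam_nonneg q)) hT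
  have h7 := mul_nonneg (gam_nonneg q) hT
  have h8 := mul_le_mul_of_nonneg_left hc (gam_nonneg K)
  rw [hg]
  linarith

/-- A sum over `Fin n` whose terms vanish beyond `j`. -/
theorem sum_fin_eq_sum_range_add {f : Fin n → ℝ} (j : Fin n) (hf : ∀ l, j < l → f l = 0) :
    ∑ l, f l = ∑ l ∈ range j, (if h : l < n then f ⟨l, h⟩ else 0) + f j := by
  have h1 : ∑ l, f l = ∑ l ∈ range n, (if h : l < n then f ⟨l, h⟩ else 0) := by
    rw [← Fin.sum_univ_eq_sum_range]
    simp
  have h2 : ∑ l ∈ range (j + 1), (if h : l < n then f ⟨l, h⟩ else 0) =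
      ∑ l ∈ range n, (if h : l < n then f ⟨l, h⟩ else 0) := by
    refine sum_subset (range_subset_range.2 j.2) fun l hl hl' => ?_
    rw [mem_range] at hl hl'
    rw [dif_pos hl]
    exact hf _ (Fin.lt_def.2 (by simp only; omega))
  rw [h1, ← h2, sum_range_succ]
  simp

/-- The computed row `w` satisfies `w Y ≈ x`, with an error relative to `|w| |Y|`. -/
theorem abs_flSolve_mul_sub_le (hfl : IsRounding fl) {X : Matrix (Fin m) (Fin n) ℝ}
    {Y : Matrix (Fin n) (Fin n) ℝ} (htri : ∀ l j, j < l → Y l j = 0) (hd : ∀ j, Y j j ≠ 0)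
    (i : Fin m) (j : Fin n) :
    |(flSolve fl X Y * Y - X) i j| ≤ gam n * ∑ l, |flSolve fl X Y i l * Y l j| := by
  set w : Fin n → ℝ := fun l => flSolve fl X Y i l with hw
  have h1 := hfl.abs_sub_le (flSolveRest fl Y (X i) j j / Y j j)
  have h2 : |flSolveRest fl Y (X i) j j - w j * Y j j| ≤ gam 1 * |w j * Y j j| := by
    have : flSolveRest fl Y (X i) j j - w j * Y j j =
        -((w j - flSolveRest fl Y (X i) j j / Y j j) * Y j j) := by
      field_simp [hd j]
      ring
    rw [this, abs_neg, abs_mul, abs_mul, ← mul_assoc]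
    exact mul_le_mul_of_nonneg_right h1 (abs_nonneg _)
  have h3 := abs_chain_end_le hfl (ρ := fun k => flSolveRest fl Y (X i) k j)
    (b := fun l => if h : l < n then w ⟨l, h⟩ * Y ⟨l, h⟩ j else 0) (K := j) (q := 1)
    (c := w j * Y j j) (fun l hl => by
      have hl' : l < n := hl.trans j.2
      simp only [flSolveRest, dif_pos hl']
      rfl) h2
  have e1 := sum_fin_eq_sum_range_add (f := fun l => w l * Y l j) j
    fun l hl => by simp only [htri l j hl, mul_zero]
  have e2 := sum_fin_eq_sum_range_add (f := fun l => |w l * Y l j|) j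
    fun l hl => by simp only [htri l j hl, mul_zero, abs_zero]
  have e3 : (flSolve fl X Y * Y - X) i j = -(X i j - ∑ l, w l * Y l j) := by
    simp [Matrix.mul_apply, hw]
  have e4 : ∀ l, |if h : l < n then w ⟨l, h⟩ * Y ⟨l, h⟩ j else 0| =
      if h : l < n then |w ⟨l, h⟩ * Y ⟨l, h⟩ j| else 0 := fun l => by split_ifs <;> simp
  simp only [e4] at h3
  rw [e3, abs_neg, e1, e2, ← sub_sub]
  -- Column `j` undergoes `j` subtractions and one division, and `j + 1 ≤ n`.
  refine h3.trans (mul_le_mul_of_nonneg_right (gam_mono j.2) ?_)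
  rw [← e2]
  exact sum_nonneg fun _ _ => abs_nonneg _

/-! ### The computed Cholesky factor -/

theorem flCholesky_apply_of_lt (A : Matrix (Fin n) (Fin n) ℝ) {l j : Fin n} (h : j < l) :
    flCholesky fl A l j = 0 := by
  simp [flCholesky, flCholRow, h]

theorem flCholesky_apply_self (A : Matrix (Fin n) (Fin n) ℝ) (l : Fin n) :
    flCholesky fl A l l = fl √(flCholRest fl A l l l) := by
  simp [flCholesky, flCholRow]

theorem flCholesky_apply_of_gt (A : Matrix (Fin n) (Fin n) ℝ) {l j : Fin n} (h : l < j) :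
    flCholesky fl A l j = fl (flCholRest fl A l l j / flCholesky fl A l l) := by
  simp [flCholesky, flCholRow, h.ne', h.not_gt]

theorem flCholRest_succ (A : Matrix (Fin n) (Fin n) ℝ) {l : ℕ} (hl : l < n) (i j : Fin n) :
    flCholRest fl A (l + 1) i j = fl (flCholRest fl A l i j -
      fl (flCholesky fl A ⟨l, hl⟩ i * flCholesky fl A ⟨l, hl⟩ j)) := by
  simp only [flCholRest, dif_pos hl]
  rfl

theorem flCholesky_self_pos (hfl : IsRounding fl) {A : Matrix (Fin n) (Fin n) ℝ} {i : Fin n}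
    (hi : 0 < flCholRest fl A i i i) : 0 < flCholesky fl A i i := by
  rw [flCholesky_apply_self]
  have h1 := (abs_le.1 (hfl √(flCholRest fl A i i i))).1
  have h2 := Real.sqrt_pos.2 hi
  rw [abs_of_pos h2] at h1
  have := u_le
  nlinarith

theorem abs_rest_self_sub_le (hfl : IsRounding fl) {A : Matrix (Fin n) (Fin n) ℝ} {i : Fin n}
    (hi : 0 < flCholRest fl A i i i) :
    |flCholRest fl A i i i - flCholesky fl A i i * flCholesky fl A i i| ≤
      gam 2 * |flCholesky fl A i i * flCholesky fl A i i| := by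
  have hR := flCholesky_self_pos hfl hi
  have h1 := hfl.abs_sub_le √(flCholRest fl A i i i)
  rw [← flCholesky_apply_self (fl := fl), abs_of_pos hR] at h1
  have h2 := Real.sq_sqrt hi.le
  have h3 := Real.sqrt_nonneg (flCholRest fl A i i i)
  set R := flCholesky fl A i i
  set t := √(flCholRest fl A i i i)
  have hg : gam 2 = 2 * gam 1 + gam 1 ^ 2 := by
    have := one_add_gam_add 1 1
    norm_num at this
    linarith
  rw [← h2, abs_of_pos (mul_pos hR hR), hg]
  have h4 := abs_le.1 h1
  have h5 := gam_nonneg 1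
  rw [abs_le]
  have h6 : t ≤ (1 + gam 1) * R := by linarith
  have h7 : (1 - gam 1) * R ≤ t := by linarith
  have h8 : gam 1 < 1 := by
    have := u_le
    rw [gam_one, div_lt_one] <;> linarith
  have h9 : ((1 - gam 1) * R) ^ 2 ≤ t ^ 2 := pow_le_pow_left₀ (by nlinarith) h7 2
  have h10 : t ^ 2 ≤ ((1 + gam 1) * R) ^ 2 := pow_le_pow_left₀ h3 h6 2
  constructor <;> nlinarith [mul_pos hR hR, mul_nonneg (mul_nonneg h5 h5) (mul_pos hR hR).le]

/-- Only the pivot of row `i` has to be positive, so the bound is available for the rows completed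
before a breakdown. The count is `i` subtractions plus at most 2 roundings, and `i + 2 ≤ n + 1`. -/
theorem abs_sub_cholesky_le (hfl : IsRounding fl) {A : Matrix (Fin n) (Fin n) ℝ} {i j : Fin n}
    (hij : i ≤ j) (hi : 0 < flCholRest fl A i i i) :
    |A i j - ∑ l, flCholesky fl A l i * flCholesky fl A l j| ≤
      gam (n + 1) * ∑ l, |flCholesky fl A l i * flCholesky fl A l j| := by
  set R := flCholesky fl A
  have hRi : 0 < R i i := flCholesky_self_pos hfl hi
  obtain ⟨q, hq, hend⟩ : ∃ q : ℕ, i + q ≤ n + 1 ∧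
      |flCholRest fl A i i j - R i i * R i j| ≤ gam q * |R i i * R i j| := by
    rcases hij.eq_or_lt with rfl | hlt
    · exact ⟨2, by omega, abs_rest_self_sub_le hfl hi⟩
    · refine ⟨1, by omega, ?_⟩
      have h1 := hfl.abs_sub_le (flCholRest fl A i i j / R i i)
      rw [← flCholesky_apply_of_gt (fl := fl) A hlt] at h1
      have : flCholRest fl A i i j - R i i * R i j =
          -((R i j - flCholRest fl A i i j / R i i) * R i i) := by
        field_simp
        ring
      rw [this, abs_neg, abs_mul, mul_comm (R i i), abs_mul, ← mul_assoc]
      exact mul_le_mul_of_nonneg_right h1 (abs_nonneg _)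
  have h3 := abs_chain_end_le hfl (ρ := fun k => flCholRest fl A k i j)
    (b := fun l => if h : l < n then R ⟨l, h⟩ i * R ⟨l, h⟩ j else 0) (K := i) (q := q)
    (c := R i i * R i j) (fun l hl => by
      have hl' : l < n := hl.trans i.2
      simp only [dif_pos hl']
      exact flCholRest_succ A hl' i j) hend
  have hz : ∀ l, i < l → R l i = 0 := fun l hl => flCholesky_apply_of_lt A hl
  have e1 := sum_fin_eq_sum_range_add (f := fun l => R l i * R l j) i
    fun l hl => by simp only [hz l hl, zero_mul]
  have e2 := sum_fin_eq_sum_range_add (f := fun l => |R l i * R l j|) i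
    fun l hl => by simp only [hz l hl, zero_mul, abs_zero]
  have e4 : ∀ l, |if h : l < n then R ⟨l, h⟩ i * R ⟨l, h⟩ j else 0| =
      if h : l < n then |R ⟨l, h⟩ i * R ⟨l, h⟩ j| else 0 := fun l => by split_ifs <;> simp
  simp only [e4] at h3
  rw [e1, e2, ← sub_sub]
  refine h3.trans (mul_le_mul_of_nonneg_right (gam_mono hq) ?_)
  rw [← e2]
  exact sum_nonneg fun _ _ => abs_nonneg _

end Rounding

/-! ### Trace bounds and completion of Cholesky factorization -/

theorem normF_sq_eq_trace (R : Matrix (Fin m) (Fin n) ℝ) : normF R ^ 2 = (Rᵀ * R).trace := by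
  rw [normF_sq, sum_comm]
  simp [Matrix.trace, Matrix.mul_apply, pow_two]

/-- If the diagonal of `RᵀR` agrees with that of `B` up to a relative error `g`, then the trace of
`B` bounds the Frobenius norm of `R`. -/
theorem normF_sq_le_trace {B R : Matrix (Fin n) (Fin n) ℝ} {g : ℝ}
    (h : ∀ j, |B j j - ∑ l, R l j * R l j| ≤ g * ∑ l, |R l j * R l j|) :
    (1 - g) * normF R ^ 2 ≤ B.trace := by
  rw [normF_sq_eq_trace, Matrix.trace, Matrix.trace, mul_sum]
  refine sum_le_sum fun j _ => ?_
  have h1 := h j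
  have h2 : ∑ l, |R l j * R l j| = ∑ l, R l j * R l j :=
    sum_congr rfl fun l _ => abs_of_nonneg (mul_self_nonneg _)
  rw [h2] at h1
  have := (abs_le.1 h1).1
  simp only [Matrix.diag_apply, Matrix.mul_apply, Matrix.transpose_apply]
  linarith

theorem le_diag_of_lower_bound {A : Matrix (Fin n) (Fin n) ℝ} {lam : ℝ}
    (hA : ∀ x, lam * vn x ^ 2 ≤ x ⬝ᵥ (A *ᵥ x)) (j : Fin n) : lam ≤ A j j := by
  have := hA (Pi.single j 1)
  simpa [vn_single] using this

/-- Multiplying the off-diagonal part of a row and a column by `τ ∈ [0, 1]` keeps a matrix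
positive definite. -/
theorem lower_bound_scale {A : Matrix (Fin n) (Fin n) ℝ} {lam τ : ℝ}
    (hA : ∀ x, lam * vn x ^ 2 ≤ x ⬝ᵥ (A *ᵥ x)) (k : Fin n) (h0 : 0 ≤ τ) (h1 : τ ≤ 1)
    (y : Fin n → ℝ) :
    lam * vn y ^ 2 ≤
      y ⬝ᵥ ((Matrix.of fun i j => if (i = k ↔ j = k) then A i j else τ * A i j) *ᵥ y) := by
  -- With `D = diag ε`, the scaled matrix is the convex combination `(1 + τ)/2 · A + (1 - τ)/2 · D A
  -- D`, and `D` is orthogonal.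
  set ε : Fin n → ℝ := fun i => if i = k then -1 else 1 with hε
  set z : Fin n → ℝ := fun i => ε i * y i with hz
  have hε2 : ∀ i, ε i ^ 2 = 1 := fun i => by simp only [hε]; split_ifs <;> norm_num
  have hvn : vn z ^ 2 = vn y ^ 2 := by
    rw [vn_sq, vn_sq]
    exact sum_congr rfl fun i _ => by rw [hz, mul_pow, hε2, one_mul]
  have e : y ⬝ᵥ ((Matrix.of fun i j => if (i = k ↔ j = k) then A i j else τ * A i j) *ᵥ y) =
      (1 + τ) / 2 * (y ⬝ᵥ (A *ᵥ y)) + (1 - τ) / 2 * (z ⬝ᵥ (A *ᵥ z)) := by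
    simp only [dotProduct, Matrix.mulVec, mul_sum, ← sum_add_distrib, Matrix.of_apply]
    refine sum_congr rfl fun i _ => sum_congr rfl fun j _ => ?_
    simp only [hz, hε]
    by_cases hi : i = k <;> by_cases hj : j = k <;> simp [hi, hj] <;> ring
  have h2 := mul_le_mul_of_nonneg_left (hA y) (by linarith : 0 ≤ (1 + τ) / 2)
  have h3 := mul_le_mul_of_nonneg_left (hA z) (by linarith : 0 ≤ (1 - τ) / 2)
  rw [hvn] at h3
  rw [e]
  linarith

/-- There are `k` equations in the `k + 1` unknowns up to index `k`. Completing them by a zero row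
and by unit rows beyond `k` gives a singular square matrix whose kernel is as required. -/
theorem exists_kernel_vector (M : Matrix (Fin n) (Fin n) ℝ) (k : Fin n) :
    ∃ y : Fin n → ℝ, y ≠ 0 ∧ (∀ j, k < j → y j = 0) ∧ ∀ l < k, M l ⬝ᵥ y = 0 := by
  set N : Matrix (Fin n) (Fin n) ℝ := Matrix.of fun l =>
    if l < k then M l else if l = k then 0 else Pi.single l 1 with hN
  have hdet : N.det = 0 := Matrix.det_eq_zero_of_row_eq_zero k fun j => by simp [hN]
  obtain ⟨y, hy, hNy⟩ := Matrix.exists_mulVec_eq_zero_iff.2 hdet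
  refine ⟨y, hy, fun j hj => ?_, fun l hl => ?_⟩
  · have := congrFun hNy j
    simpa [Matrix.mulVec, hN, hj.not_gt, hj.ne'] using this
  · have := congrFun hNy l
    simpa [Matrix.mulVec, hN, hl] using this

section Rounding

variable {fl : ℝ → ℝ}

/-- Cholesky factorization runs to completion if the smallest eigenvalue is large compared with
the rounding errors. -/
theorem choleskyCompletes_of_lower_bound (hfl : IsRounding fl) {A : Matrix (Fin n) (Fin n) ℝ}
    (hsymm : Aᵀ = A) {lam : ℝ} (hlam : 0 < lam) (hA : ∀ x, lam * vn x ^ 2 ≤ x ⬝ᵥ (A *ᵥ x))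
    (hg1 : gam (n + 1) < 1) (hg : gam (n + 1) * A.trace < (1 - gam (n + 1)) * lam) :
    CholeskyCompletes fl A := by
  set g := gam (n + 1) with hgdef
  have hg0 : 0 ≤ g := gam_nonneg _
  set R := flCholesky fl A with hR
  intro k
  induction k using WellFoundedLT.induction with
  | _ k ih =>
  by_contra hneg
  push Not at hneg
  have hAkk : 0 < A k k := hlam.trans_le (le_diag_of_lower_bound hA k)
  set T := ∑ l ∈ univ.filter (· < k), R l k * R l k with hT
  have hT0 : 0 ≤ T := sum_nonneg fun _ _ => mul_self_nonneg _
  -- the entries of the computed column above the bad pivot are too large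
  have hAT : A k k ≤ (1 + g) * T := by
    have h1 := abs_chain_le hfl (ρ := fun l => flCholRest fl A l k k)
      (b := fun l => if h : l < n then R ⟨l, h⟩ k * R ⟨l, h⟩ k else 0) (K := k) (fun l hl => by
        have hl' : l < n := hl.trans k.2
        simp only [dif_pos hl']
        exact flCholRest_succ A hl' k k)
    have e := sum_fin_eq_sum_range_add (f := fun l => if l < k then R l k * R l k else 0) k
      fun l hl => by simp [hl.not_gt]
    have e1 : ∑ l ∈ range k, (if h : l < n then R ⟨l, h⟩ k * R ⟨l, h⟩ k else 0) = T := by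
      rw [hT, sum_filter, e]
      simp only [lt_irrefl, if_false, add_zero]
      refine sum_congr rfl fun l hl => ?_
      have hl1 := mem_range.1 hl
      have hl' : l < n := hl1.trans k.2
      simp [hl', Fin.lt_def, hl1]
    have e2 : ∑ l ∈ range k, |if h : l < n then R ⟨l, h⟩ k * R ⟨l, h⟩ k else 0| = T := by
      rw [← e1]
      refine sum_congr rfl fun l hl => abs_of_nonneg ?_
      split_ifs
      · exact mul_self_nonneg _
      · exact le_rfl
    simp only [e1, e2, abs_of_nonpos hneg] at h1
    have h2 := (abs_le.1 h1).2
    have h3 : flCholRest fl A 0 k k = A k k := rfl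
    have h4 : gam (k : ℕ) ≤ g := gam_mono (by omega)
    have h5 := gam_nonneg (k : ℕ)
    rw [h3] at h2
    have h6 := mul_le_mul_of_nonneg_right h4 (by linarith : 0 ≤ T + -flCholRest fl A k k k)
    nlinarith
  have hTpos : 0 < T := by
    by_contra h
    have : T = 0 := by linarith
    rw [this] at hAT
    linarith
  -- scale that column so that the factor is singular
  set τ := √(A k k / ((1 + g) * T)) with hτ
  have hτ0 : 0 ≤ τ := Real.sqrt_nonneg _
  have hτ1 : τ ≤ 1 := Real.sqrt_le_one.2 ((div_le_one (by positivity)).2 hAT)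
  have hτ2 : τ * τ * ((1 + g) * T) = A k k := by
    rw [hτ, Real.mul_self_sqrt (by positivity)]
    field_simp
  -- The rows above the bad pivot, with column `k` scaled by `τ`: `k` non-zero rows on `k + 1`
  -- columns, hence a kernel vector supported there.
  set P : Matrix (Fin n) (Fin n) ℝ := Matrix.of fun l j =>
    if l < k then (if j < k then R l j else if j = k then τ * R l j else 0) else 0 with hP
  obtain ⟨y, hy0, hysup, hyker⟩ := exists_kernel_vector P k
  have hPy : P *ᵥ y = 0 := by
    ext l
    by_cases hl : l < k
    · exact hyker l hl
    · simp [Matrix.mulVec, hP, hl, dotProduct]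
  -- Off the diagonal, row and column `k` of `A` are scaled by the same `τ`, so the entrywise errors
  -- scale along. The entry `(k, k)` stays, and `τ` is chosen so that it exceeds that of `PᵀP` by
  -- exactly the allowed relative error `g`.
  set B : Matrix (Fin n) (Fin n) ℝ :=
    Matrix.of fun i j => if (i = k ↔ j = k) then A i j else τ * A i j with hB
  set B' : Matrix (Fin n) (Fin n) ℝ :=
    Matrix.of fun i j => if i ≤ k ∧ j ≤ k then B i j else 0 with hB'
  have hBB : y ⬝ᵥ (B' *ᵥ y) = y ⬝ᵥ (B *ᵥ y) := by
    simp only [dotProduct, Matrix.mulVec, mul_sum]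
    refine sum_congr rfl fun i _ => sum_congr rfl fun j _ => ?_
    by_cases hi : i ≤ k
    · by_cases hj : j ≤ k
      · simp [hB', hi, hj]
      · simp [hysup j (not_le.1 hj)]
    · simp [hysup i (not_le.1 hi)]
  have hQ := lower_bound_scale hA k hτ0 hτ1 y
  have herr : ∀ i j, i < k → i ≤ j →
      |A i j - ∑ l, R l i * R l j| ≤ g * ∑ l, |R l i * R l j| := fun i j hi hij =>
    abs_sub_cholesky_le hfl hij (ih i hi)
  have hRP : ∀ i j, i < k → ∑ l, R l i * R l j = ∑ l, if l < k then R l i * R l j else 0 :=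
    fun i j hi => sum_congr rfl fun l _ => by
      split_ifs with hl
      · rfl
      · rw [hR, flCholesky_apply_of_lt A (hi.trans_le (not_lt.1 hl)), zero_mul]
  have hRP' : ∀ i j, i < k → ∑ l, |R l i * R l j| = ∑ l, if l < k then |R l i * R l j| else 0 :=
    fun i j hi => sum_congr rfl fun l _ => by
      split_ifs with hl
      · rfl
      · rw [hR, flCholesky_apply_of_lt A (hi.trans_le (not_lt.1 hl)), zero_mul, abs_zero]
  have hA' : ∀ i j, A j i = A i j := fun i j => congrFun (congrFun hsymm i) j
  have hupper : ∀ i j, i ≤ j →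
      |B' i j - ∑ l, P l i * P l j| ≤ g * ∑ l, |P l i * P l j| := by
    intro i j hij
    by_cases hj : j ≤ k
    · rcases hj.eq_or_lt with rfl | hjk
      · rcases hij.eq_or_lt with rfl | hik
        · have e1 : ∑ l, P l i * P l i = τ * τ * T := by
            rw [hT, sum_filter, mul_sum]
            refine sum_congr rfl fun l _ => ?_
            simp only [hP, Matrix.of_apply, lt_irrefl, if_false, if_true]
            split_ifs <;> ring
          have e2 : ∑ l, |P l i * P l i| = τ * τ * T := by
            rw [← e1]
            exact sum_congr rfl fun l _ => abs_of_nonneg (mul_self_nonneg _)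
          have e3 : B' i i = A i i := by simp [hB', hB]
          rw [e1, e2, e3, ← hτ2]
          have : τ * τ * ((1 + g) * T) - τ * τ * T = g * (τ * τ * T) := by ring
          rw [this, abs_of_nonneg (by positivity)]
        · have h := herr i j hik hij
          rw [hRP i j hik, hRP' i j hik] at h
          have e1 : ∑ l, P l i * P l j = τ * ∑ l, if l < j then R l i * R l j else 0 := by
            rw [mul_sum]
            refine sum_congr rfl fun l _ => ?_
            simp only [hP, Matrix.of_apply, lt_irrefl, if_false, if_true, hik]
            split_ifs <;> ring
          have e2 : ∑ l, |P l i * P l j| = τ * ∑ l, if l < j then |R l i * R l j| else 0 := by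
            rw [mul_sum]
            refine sum_congr rfl fun l _ => ?_
            simp only [hP, Matrix.of_apply, lt_irrefl, if_false, if_true, hik]
            split_ifs
            · rw [mul_left_comm, abs_mul, abs_of_nonneg hτ0]
            · simp
          have e3 : B' i j = τ * A i j := by simp [hB', hB, hij, hik.ne]
          rw [e1, e2, e3, ← mul_sub, abs_mul, abs_of_nonneg hτ0, mul_left_comm]
          exact mul_le_mul_of_nonneg_left h hτ0
      · have hik := hij.trans_lt hjk
        have h := herr i j hik hij
        rw [hRP i j hik, hRP' i j hik] at h
        have e1 : ∑ l, P l i * P l j = ∑ l, if l < k then R l i * R l j else 0 := by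
          refine sum_congr rfl fun l _ => ?_
          simp only [hP, Matrix.of_apply, hik, hjk, if_true]
          split_ifs <;> ring
        have e2 : ∑ l, |P l i * P l j| = ∑ l, if l < k then |R l i * R l j| else 0 := by
          refine sum_congr rfl fun l _ => ?_
          simp only [hP, Matrix.of_apply, hik, hjk, if_true]
          split_ifs <;> simp
        have e3 : B' i j = A i j := by simp [hB', hB, hik.le, hjk.le, hik.ne, hjk.ne]
        rwa [e1, e2, e3]
    · have hjk := not_le.1 hj
      have e1 : ∀ l, P l i * P l j = 0 := fun l => by
        simp [hP, hjk.not_gt, hjk.ne']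
      simp [e1, hB', hj]
  have hE : ∀ i j, |(B' - Pᵀ * P) i j| ≤ g * ∑ l, |Pᵀ i l * P l j| := by
    intro i j
    simp only [Matrix.sub_apply, Matrix.mul_apply, Matrix.transpose_apply]
    rcases le_total i j with hij | hij
    · exact hupper i j hij
    · have := hupper j i hij
      have e3 : B' i j = B' j i := by
        simp only [hB', hB, Matrix.of_apply, hA' i j, and_comm, iff_comm]
      rw [e3]
      simpa only [mul_comm] using this
  have hF := normF_le_of_abs_le hg0 hE
  rw [normF_transpose, ← pow_two] at hF
  have htr := normF_sq_le_trace (B := B') (R := P) (g := g) fun j => hupper j j le_rfl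
  have htr2 : B'.trace ≤ A.trace := by
    refine sum_le_sum fun j _ => ?_
    have := hlam.le.trans (le_diag_of_lower_bound hA j)
    by_cases hj : j ≤ k
    · simp [hB', hB, hj]
    · simp [hB', hj, this]
  have h1 := abs_dot_mulVec_le (B' - Pᵀ * P) y
  -- On the kernel vector the form of `PᵀP` vanishes, so the error matrix alone must account for the
  -- lower bound `lam`; the trace bound on `P` makes that impossible.
  have h2 : y ⬝ᵥ ((B' - Pᵀ * P) *ᵥ y) = y ⬝ᵥ (B *ᵥ y) := by
    rw [Matrix.sub_mulVec, dotProduct_sub, hBB, ← Matrix.mulVec_mulVec, hPy]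
    simp
  rw [h2] at h1
  have h3 := (le_abs_self _).trans h1
  have hvy : 0 < vn y ^ 2 := pow_pos (vn_pos hy0) 2
  have h4 : lam ≤ normF (B' - Pᵀ * P) := le_of_mul_le_mul_right (hQ.trans h3) hvy
  have h5 : (1 - g) * lam ≤ (1 - g) * (g * normF P ^ 2) :=
    mul_le_mul_of_nonneg_left (h4.trans hF) (by linarith)
  have h6 : g * ((1 - g) * normF P ^ 2) ≤ g * A.trace :=
    mul_le_mul_of_nonneg_left (htr.trans htr2) hg0
  linarith

theorem abs_cholesky_sub_le (hfl : IsRounding fl) {A : Matrix (Fin n) (Fin n) ℝ}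
    (hsymm : Aᵀ = A) (hc : CholeskyCompletes fl A) (i j : Fin n) :
    |((flCholesky fl A)ᵀ * flCholesky fl A - A) i j| ≤
      gam (n + 1) * ∑ l, |(flCholesky fl A)ᵀ i l * flCholesky fl A l j| := by
  simp only [Matrix.sub_apply, Matrix.mul_apply, Matrix.transpose_apply]
  rw [abs_sub_comm]
  rcases le_total i j with hij | hij
  · exact abs_sub_cholesky_le hfl hij (hc i)
  · have := abs_sub_cholesky_le hfl hij (hc j)
    rw [show A i j = A j i from congrFun (congrFun hsymm j) i]
    simpa only [mul_comm] using this

theorem normF_cholesky_sub_le (hfl : IsRounding fl) {A : Matrix (Fin n) (Fin n) ℝ}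
    (hsymm : Aᵀ = A) (hc : CholeskyCompletes fl A) :
    normF ((flCholesky fl A)ᵀ * flCholesky fl A - A) ≤ gam (n + 1) * normF (flCholesky fl A) ^ 2 := by
  have := normF_le_of_abs_le (gam_nonneg _) (abs_cholesky_sub_le hfl hsymm hc)
  rwa [normF_transpose, ← pow_two] at this

theorem normF_cholesky_sq_le (hfl : IsRounding fl) {A : Matrix (Fin n) (Fin n) ℝ}
    (hc : CholeskyCompletes fl A) :
    (1 - gam (n + 1)) * normF (flCholesky fl A) ^ 2 ≤ A.trace :=
  normF_sq_le_trace fun j => abs_sub_cholesky_le hfl le_rfl (hc j)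

theorem normF_flSolve_cholesky_le (hfl : IsRounding fl) {A : Matrix (Fin n) (Fin n) ℝ}
    (hc : CholeskyCompletes fl A) (X : Matrix (Fin m) (Fin n) ℝ) :
    normF (flSolve fl X (flCholesky fl A) * flCholesky fl A - X) ≤
      gam n * (normF (flSolve fl X (flCholesky fl A)) * normF (flCholesky fl A)) :=
  normF_le_of_abs_le (gam_nonneg _) <| abs_flSolve_mul_sub_le hfl
    (fun _ _ h => flCholesky_apply_of_lt A h) (fun j => (flCholesky_self_pos hfl (hc j)).ne')

/-- The computed Gram matrix is symmetric exactly: mirrored entries round the same products and sum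
them in the same order. -/
theorem flMul_transpose_self_symm (X : Matrix (Fin m) (Fin n) ℝ) :
    (flMul fl Xᵀ X)ᵀ = flMul fl Xᵀ X := by
  ext i j
  simp only [flMul, Matrix.transpose_apply, Matrix.of_apply, mul_comm]

theorem flAddShift_symm {G : Matrix (Fin n) (Fin n) ℝ} (hG : Gᵀ = G) (s : ℝ) :
    (flAddShift fl G s)ᵀ = flAddShift fl G s := by
  ext i j
  have hij : G j i = G i j := congrFun (congrFun hG i) j
  by_cases h : i = j
  · subst h; simp [flAddShift]
  · simp [flAddShift, h, Ne.symm h, hij]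

end Rounding

/-! ### Perturbed triangular systems -/

/-- Substituting `z = Yx` gives `Wz = Xx + (WY - X)x`. The error bound contains `‖W‖` itself, so the
estimate has the form `‖W‖ ≤ μ + δ‖W‖` and is solved for `‖W‖`. -/
theorem norm2_solve_le {X W : Matrix (Fin m) (Fin n) ℝ} {Y : Matrix (Fin n) (Fin n) ℝ}
    {g ρ μ δ : ℝ} (hg : 0 ≤ g) (hρ : 0 < ρ) (hμ : 0 ≤ μ) (hδ : 0 ≤ δ)
    (hY : ∀ x, ρ * vn x ≤ vn (Y *ᵥ x)) (hXY : ∀ x, vn (X *ᵥ x) ≤ μ * vn (Y *ᵥ x))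
    (hE : normF (W * Y - X) ≤ g * (normF W * normF Y)) (hgδ : g * (√n * normF Y) ≤ δ * ρ) :
    (1 - δ) * norm2 W ≤ μ := by
  have hE' : normF (W * Y - X) ≤ norm2 W * (δ * ρ) := by
    have h1 := mul_le_mul_of_nonneg_right (normF_le_sqrt_mul W) (normF_nonneg Y)
    have h2 := mul_le_mul_of_nonneg_left h1 hg
    have h3 := mul_le_mul_of_nonneg_left hgδ (norm2_nonneg W)
    linarith
  have : norm2 W ≤ μ + norm2 W * δ := by
    refine norm2_le (add_nonneg hμ (mul_nonneg (norm2_nonneg _) hδ)) fun z => ?_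
    obtain ⟨x, rfl⟩ := exists_mulVec_eq_of_lower_bound hρ hY z
    have e : W *ᵥ (Y *ᵥ x) = X *ᵥ x + (W * Y - X) *ᵥ x := by
      rw [Matrix.sub_mulVec, Matrix.mulVec_mulVec]; simp
    have h1 := (vn_mulVec_le_normF (W * Y - X) x).trans
      (mul_le_mul_of_nonneg_right hE' (vn_nonneg x))
    have h2 := mul_le_mul_of_nonneg_left (hY x) (mul_nonneg (norm2_nonneg W) hδ)
    rw [e]
    refine (vn_add_le _ _).trans ?_
    have := hXY x
    linarith
  linarith

theorem solve_lower_bound {X W : Matrix (Fin m) (Fin n) ℝ} {Y : Matrix (Fin n) (Fin n) ℝ}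
    {ρ σ ν η : ℝ} (hρ : 0 < ρ) (hη : 0 ≤ η) (hη1 : η ≤ 1)
    (hY : ∀ x, ρ * vn x ≤ vn (Y *ᵥ x)) (hX : ∀ x, σ * vn x ≤ vn (X *ᵥ x))
    (hXY : ∀ x, ν * vn (Y *ᵥ x) ≤ vn (X *ᵥ x))
    (hE : normF (W * Y - X) ≤ η * σ) (z : Fin n → ℝ) : (1 - η) * ν * vn z ≤ vn (W *ᵥ z) := by
  obtain ⟨x, rfl⟩ := exists_mulVec_eq_of_lower_bound hρ hY z
  have e : W *ᵥ (Y *ᵥ x) = X *ᵥ x + (W * Y - X) *ᵥ x := by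
    rw [Matrix.sub_mulVec, Matrix.mulVec_mulVec]; simp
  have h1 := (vn_mulVec_le_normF (W * Y - X) x).trans
    (mul_le_mul_of_nonneg_right hE (vn_nonneg x))
  have h2 := mul_le_mul_of_nonneg_left (hX x) hη
  have h3 := vn_le_add_sub (X *ᵥ x) ((W * Y - X) *ᵥ x)
  rw [← e] at h3
  have h4 := mul_le_mul_of_nonneg_left (hXY x) (by linarith : 0 ≤ 1 - η)
  linarith

/-- A congruence `Rᵀ N R` bounds `N` in the Frobenius norm. -/
theorem normF_le_of_congruence {N R : Matrix (Fin n) (Fin n) ℝ} {ρ : ℝ} (hρ : 0 < ρ)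
    (hR : ∀ x, ρ * vn x ≤ vn (R *ᵥ x)) : ρ ^ 2 * normF N ≤ normF (Rᵀ * N * R) := by
  have hsurj := exists_mulVec_eq_of_lower_bound hρ hR
  have hunit : IsUnit R := Matrix.mulVec_surjective_iff_isUnit.1 hsurj
  have hdet : IsUnit R.det := (Matrix.isUnit_iff_isUnit_det R).1 hunit
  have hinv : norm2 R⁻¹ ≤ ρ⁻¹ := by
    refine norm2_le (inv_nonneg.2 hρ.le) fun z => ?_
    have := hR (R⁻¹ *ᵥ z)
    rw [Matrix.mulVec_mulVec, Matrix.mul_nonsing_inv R hdet, Matrix.one_mulVec] at this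
    rwa [inv_mul_eq_div, le_div_iff₀ hρ, mul_comm]
  have e : N = (R⁻¹)ᵀ * ((Rᵀ * N * R) * R⁻¹) := by
    rw [Matrix.mul_assoc (Rᵀ * N), Matrix.mul_nonsing_inv R hdet, Matrix.mul_one,
      ← Matrix.mul_assoc, ← Matrix.transpose_mul, Matrix.mul_nonsing_inv R hdet]
    simp
  have h1 : normF N ≤ ρ⁻¹ * (normF (Rᵀ * N * R) * ρ⁻¹) := by
    calc normF N = normF ((R⁻¹)ᵀ * ((Rᵀ * N * R) * R⁻¹)) := by rw [← e]
      _ ≤ norm2 (R⁻¹)ᵀ * normF ((Rᵀ * N * R) * R⁻¹) := normF_mul_le _ _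
      _ ≤ ρ⁻¹ * (normF (Rᵀ * N * R) * ρ⁻¹) := by
        rw [norm2_transpose]
        refine mul_le_mul hinv ?_ (normF_nonneg _) (inv_nonneg.2 hρ.le)
        exact (normF_mul_le' _ _).trans (mul_le_mul_of_nonneg_left hinv (normF_nonneg _))
  calc ρ ^ 2 * normF N ≤ ρ ^ 2 * (ρ⁻¹ * (normF (Rᵀ * N * R) * ρ⁻¹)) :=
        mul_le_mul_of_nonneg_left h1 (by positivity)
    _ = normF (Rᵀ * N * R) := by field_simp

/-! ### Size assumptions and the unshifted CholeskyQR step -/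

/-- The size assumptions under which the algorithms are analysed. -/
structure SizeOK (m n : ℕ) : Prop where
  two_le : 2 ≤ n
  le : n ≤ m
  small : n * (m + n + 1) * u ≤ 1 / 1100

namespace SizeOK

theorem small' (h : SizeOK m n) : (m + n + 1) * u ≤ 1 / 2200 := by
  have h1 : (2 : ℝ) ≤ n := by exact_mod_cast h.two_le
  have h2 := h.small
  have h3 : 0 ≤ (m + n + 1) * u := by have := u_pos; positivity
  nlinarith

theorem sq_le (h : SizeOK m n) : 2 * (n ^ 2 * u) ≤ n * (m + n + 1) * u := by
  have h1 : (n : ℝ) ≤ m := by exact_mod_cast h.le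
  have h2 := u_pos
  have h3 : (n : ℝ) * n ≤ n * m := mul_le_mul_of_nonneg_left h1 (Nat.cast_nonneg _)
  have h4 : 2 * (n : ℝ) ^ 2 ≤ n * (m + n + 1) := by
    have : (0 : ℝ) ≤ n := Nat.cast_nonneg _
    nlinarith
  have := mul_le_mul_of_nonneg_right h4 h2.le
  linarith

theorem gam_m (h : SizeOK m n) : gam m ≤ 1.001 * (m * u) :=
  gam_le <| by
    have := h.small'
    have := u_pos
    have : 0 ≤ (n + 1) * u := by positivity
    linarith

theorem gam_n_succ (h : SizeOK m n) : gam (n + 1) ≤ 1.001 * ((n + 1) * u) := by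
  have := gam_le (k := n + 1) <| by
    have := h.small'
    have := u_pos
    have : 0 ≤ m * u := by positivity
    push_cast
    linarith
  push_cast at this
  exact this

theorem gam_n (h : SizeOK m n) : gam n ≤ 1.001 * (n * u) :=
  gam_le <| by
    have := h.small'
    have := u_pos
    have : 0 ≤ (m + 1) * u := by positivity
    linarith

theorem gam_m_le (h : SizeOK m n) : gam m ≤ 1 / 2000 := by
  have := h.small'
  have := u_pos
  have : 0 ≤ (n + 1) * u := by positivity
  have := h.gam_m
  linarith

theorem gam_n_succ_le (h : SizeOK m n) : gam (n + 1) ≤ 1 / 2000 := by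
  have := h.small'
  have := u_pos
  have : 0 ≤ m * u := by positivity
  have := h.gam_n_succ
  linarith

end SizeOK

/-- Turns a matrix backward error into a comparison of `‖Rx‖` with `‖Xx‖` for each `x`; `s = 0`
serves the unshifted steps. -/
theorem vn_sq_sub_le {X : Matrix (Fin m) (Fin n) ℝ} {R : Matrix (Fin n) (Fin n) ℝ} {s e : ℝ}
    (h : normF (Rᵀ * R - Xᵀ * X - s • 1) ≤ e) (x : Fin n → ℝ) :
    |vn (R *ᵥ x) ^ 2 - vn (X *ᵥ x) ^ 2 - s * vn x ^ 2| ≤ e * vn x ^ 2 := by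
  have h1 := abs_dot_mulVec_le (Rᵀ * R - Xᵀ * X - s • 1) x
  have h2 : x ⬝ᵥ ((Rᵀ * R - Xᵀ * X - s • (1 : Matrix (Fin n) (Fin n) ℝ)) *ᵥ x) =
      vn (R *ᵥ x) ^ 2 - vn (X *ᵥ x) ^ 2 - s * vn x ^ 2 := by
    rw [vn_mulVec_sq, vn_mulVec_sq, vn_sq_dot, Matrix.sub_mulVec, Matrix.sub_mulVec,
      Matrix.smul_mulVec, Matrix.one_mulVec, dotProduct_sub, dotProduct_sub, dotProduct_smul,
      smul_eq_mul]
  rw [h2] at h1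
  exact h1.trans (mul_le_mul_of_nonneg_right h (by positivity))

/-- The bounds for the factors `W`, `R` computed by CholeskyQR from a well-conditioned `X`. -/
structure CholeskyQRBounds (X W : Matrix (Fin m) (Fin n) ℝ) (R : Matrix (Fin n) (Fin n) ℝ) :
    Prop where
  normF_R : normF R ≤ 1.018 * √n
  vn_R : ∀ x, vn (R *ᵥ x) ≤ 1.003 * vn (X *ᵥ x)
  norm2_W : norm2 W ≤ 1.006
  lower_W : ∀ z, 0.99 * vn z ≤ vn (W *ᵥ z)
  backward : normF (W * R - X) ≤ 1.027 * (n ^ 2 * u)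

section CholeskyQR

variable {fl : ℝ → ℝ} {X : Matrix (Fin m) (Fin n) ℝ} {σ : ℝ}

theorem trace_flMul_le (hfl : IsRounding fl) (X : Matrix (Fin m) (Fin n) ℝ) :
    (flMul fl Xᵀ X).trace ≤ (1 + gam m) * normF X ^ 2 := by
  rw [normF_sq_eq_trace, Matrix.trace, Matrix.trace, mul_sum]
  refine sum_le_sum fun j _ => ?_
  have h1 := (abs_le.1 (abs_flMul_sub_le hfl Xᵀ X j j)).2
  have h2 : ∑ l, |Xᵀ j l * X l j| = ∑ l, Xᵀ j l * X l j :=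
    sum_congr rfl fun l _ => abs_of_nonneg (mul_self_nonneg _)
  rw [h2, Matrix.sub_apply, Matrix.mul_apply] at h1
  simp only [Matrix.diag_apply, Matrix.mul_apply]
  linarith

theorem choleskyQR_completes (hfl : IsRounding fl) (hs : SizeOK m n) (hσ : 0 < σ)
    (hX : ∀ x, σ * vn x ≤ vn (X *ᵥ x)) (hXF : normF X ^ 2 ≤ 1.03 * n)
    (hσθ : n * (m + n + 1) * u ≤ σ ^ 2 / 200) : CholeskyCompletes fl (flMul fl Xᵀ X) := by
  have hn : (0 : ℝ) ≤ n := Nat.cast_nonneg _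
  have hu := u_pos
  have hG := normF_flMul_sub_le hfl Xᵀ X
  rw [normF_transpose, ← pow_two] at hG
  have g1 := mul_le_mul_of_nonneg_left hXF (gam_nonneg m)
  have g2 := mul_le_mul_of_nonneg_right hs.gam_m hn
  have g3 := mul_le_mul_of_nonneg_right hs.gam_n_succ hn
  have p1 : 0 ≤ m * u * n := by positivity
  have p2 : 0 ≤ (n + 1) * u * n := by positivity
  have htr := (trace_flMul_le hfl X).trans
    (mul_le_mul_of_nonneg_left hXF (by linarith [gam_nonneg m]))
  have htr' : (flMul fl Xᵀ X).trace ≤ 1.04 * n :=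
    htr.trans (by nlinarith [mul_le_mul_of_nonneg_right hs.gam_m_le hn])
  refine choleskyCompletes_of_lower_bound hfl (flMul_transpose_self_symm X)
    (lam := σ ^ 2 / 2) (by positivity) (fun x => ?_) (by linarith [hs.gam_n_succ_le]) ?_
  · have h1 := abs_dot_mulVec_le (flMul fl Xᵀ X - Xᵀ * X) x
    rw [Matrix.sub_mulVec, dotProduct_sub, ← vn_mulVec_sq] at h1
    have h2 := (abs_le.1 h1).1
    have h3 := pow_le_pow_left₀ (mul_nonneg hσ.le (vn_nonneg x)) (hX x) 2
    have h4 : normF (flMul fl Xᵀ X - Xᵀ * X) ≤ σ ^ 2 / 2 := by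
      nlinarith
    have h5 := mul_le_mul_of_nonneg_right h4 (sq_nonneg (vn x))
    rw [mul_pow] at h3
    linarith
  · have h1 := mul_le_mul_of_nonneg_left htr' (gam_nonneg (n + 1))
    have h2 := mul_le_mul_of_nonneg_right hs.gam_n_succ_le (sq_nonneg σ)
    have h3 : 0 < σ ^ 2 := by positivity
    nlinarith

theorem normF_cholesky_le (hfl : IsRounding fl) (hs : SizeOK m n)
    (hc : CholeskyCompletes fl (flMul fl Xᵀ X)) (hXF : normF X ^ 2 ≤ 1.03 * n) :
    normF (flCholesky fl (flMul fl Xᵀ X)) ^ 2 ≤ 1.034 * n := by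
  have hn : (0 : ℝ) ≤ n := Nat.cast_nonneg _
  have h1 := (normF_cholesky_sq_le hfl hc).trans (trace_flMul_le hfl X)
  have h2 := mul_le_mul_of_nonneg_right hs.gam_m_le (sq_nonneg (normF X))
  have h3 := mul_le_mul_of_nonneg_right hs.gam_n_succ_le
    (sq_nonneg (normF (flCholesky fl (flMul fl Xᵀ X))))
  linarith

theorem normF_cholesky_gram_le (hfl : IsRounding fl) (hs : SizeOK m n)
    (hc : CholeskyCompletes fl (flMul fl Xᵀ X)) (hXF : normF X ^ 2 ≤ 1.03 * n) :
    normF ((flCholesky fl (flMul fl Xᵀ X))ᵀ * flCholesky fl (flMul fl Xᵀ X) - Xᵀ * X) ≤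
      1.04 * (n * (m + n + 1) * u) := by
  have hn : (0 : ℝ) ≤ n := Nat.cast_nonneg _
  have hu := u_pos
  set R := flCholesky fl (flMul fl Xᵀ X)
  have hRF := normF_cholesky_le hfl hs hc hXF
  have hG := normF_flMul_sub_le hfl Xᵀ X
  rw [normF_transpose, ← pow_two] at hG
  have hC := normF_cholesky_sub_le hfl (flMul_transpose_self_symm X) hc
  have g1 := mul_le_mul hs.gam_m hXF (sq_nonneg _) (by positivity)
  have g2 := mul_le_mul hs.gam_n_succ hRF (sq_nonneg _) (by positivity)
  have h := normF_add_le (Rᵀ * R - flMul fl Xᵀ X) (flMul fl Xᵀ X - Xᵀ * X)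
  rw [sub_add_sub_cancel] at h
  have p1 : 0 ≤ m * u * n := by positivity
  have p2 : 0 ≤ (n + 1) * u * n := by positivity
  nlinarith

theorem choleskyQR_bounds (hfl : IsRounding fl) (hs : SizeOK m n) (hσ : 0 < σ) (hσ1 : σ ≤ 1.02)
    (hX : ∀ x, σ * vn x ≤ vn (X *ᵥ x)) (hXF : normF X ^ 2 ≤ 1.03 * n)
    (hσθ : n * (m + n + 1) * u ≤ σ ^ 2 / 200) (hc : CholeskyCompletes fl (flMul fl Xᵀ X)) :
    CholeskyQRBounds X (choleskyQR fl X).1 (choleskyQR fl X).2 ∧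
      ∀ x, 0.997 * vn (X *ᵥ x) ≤ vn ((choleskyQR fl X).2 *ᵥ x) := by
  have hn : (0 : ℝ) ≤ n := Nat.cast_nonneg _
  have hu := u_pos
  have hRF := normF_cholesky_le hfl hs hc hXF
  have hGr := normF_cholesky_gram_le hfl hs hc hXF
  have hback := normF_flSolve_cholesky_le hfl hc X
  simp only [choleskyQR]
  set R := flCholesky fl (flMul fl Xᵀ X)
  set W := flSolve fl X R
  have hsq : √(n : ℝ) ^ 2 = n := Real.sq_sqrt hn
  have hsq0 := Real.sqrt_nonneg (n : ℝ)
  have hRF' : normF R ≤ 1.018 * √n := by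
    refine le_of_sq_le_sq ?_ (by positivity)
    rw [mul_pow, hsq]; linarith
  -- The Gram error is at most `1.04 θ ≤ 0.0052 σ²`, and `σ²‖x‖² ≤ ‖Xx‖²`.
  have hdiff : ∀ x, |vn (R *ᵥ x) ^ 2 - vn (X *ᵥ x) ^ 2| ≤ 0.0053 * vn (X *ᵥ x) ^ 2 := by
    intro x
    have h1 := vn_sq_sub_le (s := 0) (by simpa using hGr) x
    rw [zero_mul, sub_zero] at h1
    have h2 := pow_le_pow_left₀ (mul_nonneg hσ.le (vn_nonneg x)) (hX x) 2
    rw [mul_pow] at h2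
    have h3 := mul_le_mul_of_nonneg_right hσθ (sq_nonneg (vn x))
    linarith [sq_nonneg (vn (X *ᵥ x))]
  have hup : ∀ x, vn (R *ᵥ x) ≤ 1.003 * vn (X *ᵥ x) := fun x => by
    refine le_of_sq_le_sq ?_ (mul_nonneg (by norm_num) (vn_nonneg _))
    have := (abs_le.1 (hdiff x)).2
    nlinarith [sq_nonneg (vn (X *ᵥ x))]
  have hlo : ∀ x, 0.997 * vn (X *ᵥ x) ≤ vn (R *ᵥ x) := fun x => by
    refine le_of_sq_le_sq ?_ (vn_nonneg _)
    have := (abs_le.1 (hdiff x)).1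
    nlinarith [sq_nonneg (vn (X *ᵥ x))]
  have hY : ∀ x, 0.997 * σ * vn x ≤ vn (R *ᵥ x) := fun x => by
    have := hX x
    have := hlo x
    linarith
  have hθ : n ^ 2 * u ≤ σ / 390 := by
    have h1 := hs.sq_le
    nlinarith
  have hgR : gam n * (√n * normF R) ≤ 1.02 * (n ^ 2 * u) := by
    have h1 := mul_le_mul_of_nonneg_left hRF' hsq0
    have h2 := mul_le_mul hs.gam_n h1 (mul_nonneg hsq0 (normF_nonneg _)) (by positivity)
    have h3 : 0 ≤ n ^ 2 * u := by positivity
    have h4 : 1.001 * (n * u) * (√n * (1.018 * √n)) = 1.001 * 1.018 * (n * u * √n ^ 2) := by ring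
    rw [h4, hsq] at h2
    nlinarith
  -- The constants: `1 / 0.997 < 1.0031`, `1.02 / 390 < 0.0028 · 0.997` and `1.0031 / (1 - 0.0028) <
  -- 1.006`.
  have hW : norm2 W ≤ 1.006 := by
    have := norm2_solve_le (X := X) (W := W) (Y := R) (g := gam n) (ρ := 0.997 * σ)
      (μ := 1.0031) (δ := 0.0028) (gam_nonneg n) (by positivity) (by norm_num) (by norm_num) hY
      (fun x => by linarith [hlo x, vn_nonneg (X *ᵥ x), vn_nonneg (R *ᵥ x)]) hback
      (by linarith)
    linarith
  have hb : normF (W * R - X) ≤ 1.027 * (n ^ 2 * u) := by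
    have h1 := mul_le_mul_of_nonneg_right (normF_le_sqrt_mul W) (normF_nonneg R)
    have h2 := mul_le_mul_of_nonneg_left h1 (gam_nonneg n)
    have h3 : gam n * (√n * norm2 W * normF R) = norm2 W * (gam n * (√n * normF R)) := by ring
    have h4 := mul_le_mul hW hgR (mul_nonneg (gam_nonneg n) (mul_nonneg hsq0 (normF_nonneg _)))
      (by norm_num)
    have h5 : 0 ≤ n ^ 2 * u := by positivity
    linarith
  refine ⟨⟨hRF', hup, hW, fun z => ?_, hb⟩, hlo⟩
  have := solve_lower_bound (X := X) (W := W) (Y := R) (ρ := 0.997 * σ) (σ := σ) (ν := 0.997)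
      (η := 0.003) (by positivity) (by norm_num) (by norm_num) hY hX
      (fun x => by linarith [hup x, vn_nonneg (X *ᵥ x), vn_nonneg (R *ᵥ x)])
      (by linarith) z
  linarith [vn_nonneg z]

/-- The orthogonality of the factor computed by CholeskyQR from an almost orthogonal matrix. -/
theorem choleskyQR_orthogonality (hfl : IsRounding fl) (hs : SizeOK m n)
    (hX : ∀ x, 0.99 * vn x ≤ vn (X *ᵥ x)) (hX2 : norm2 X ≤ 1.006)
    (hc : CholeskyCompletes fl (flMul fl Xᵀ X)) (hXF : normF X ^ 2 ≤ 1.03 * n)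
    (hb : CholeskyQRBounds X (choleskyQR fl X).1 (choleskyQR fl X).2)
    (hlo : ∀ x, 0.997 * vn (X *ᵥ x) ≤ vn ((choleskyQR fl X).2 *ᵥ x)) :
    normF ((choleskyQR fl X).1ᵀ * (choleskyQR fl X).1 - 1) ≤ 3 * (n * (m + n + 1) * u) := by
  have hGr := normF_cholesky_gram_le hfl hs hc hXF
  have hb := hb.backward
  simp only [choleskyQR] at hb hlo ⊢
  set R := flCholesky fl (flMul fl Xᵀ X)
  set Q := flSolve fl X R
  set E := Q * R - X with hE
  have hsq := hs.sq_le
  have hsm := hs.small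
  have hu := u_pos
  have hEF := normF_nonneg E
  -- Conjugating by `R` replaces `Q` by `QR = X + E`, so only the two backward errors `E` and `RᵀR -
  -- XᵀX` remain; `normF_le_of_congruence` then removes `R`.
  have e : Rᵀ * (Qᵀ * Q - 1) * R = Xᵀ * E + (Eᵀ * X + Eᵀ * E) + -(Rᵀ * R - Xᵀ * X) := by
    have hQR : Q * R = X + E := by rw [hE]; abel
    calc Rᵀ * (Qᵀ * Q - 1) * R = (Q * R)ᵀ * (Q * R) - Rᵀ * R := by
          rw [Matrix.transpose_mul]
          simp only [Matrix.mul_sub, Matrix.sub_mul, Matrix.mul_assoc, Matrix.mul_one]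
      _ = _ := by
          rw [hQR, Matrix.transpose_add]
          simp only [Matrix.mul_add, Matrix.add_mul]
          abel
  have h1 := normF_le_of_congruence (N := Qᵀ * Q - 1) (R := R) (ρ := 0.98) (by norm_num) fun x => by
    linarith [hX x, hlo x, vn_nonneg x]
  rw [e] at h1
  have h2 := (normF_add_le (Xᵀ * E + (Eᵀ * X + Eᵀ * E)) (-(Rᵀ * R - Xᵀ * X))).trans
    (add_le_add ((normF_add_le _ _).trans (add_le_add_right (normF_add_le _ _) _)) le_rfl)
  rw [normF_neg] at h2
  have h3 : normF (Xᵀ * E) ≤ 1.006 * normF E :=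
    (normF_mul_le _ _).trans (mul_le_mul_of_nonneg_right (norm2_transpose X ▸ hX2) hEF)
  have h4 : normF (Eᵀ * X) ≤ normF E * 1.006 := by
    refine (normF_mul_le' _ _).trans ?_
    rw [normF_transpose]
    exact mul_le_mul_of_nonneg_left hX2 hEF
  have h5 : normF (Eᵀ * E) ≤ normF E * normF E := by
    have := normF_mul_le_normF_mul_normF Eᵀ E
    rwa [normF_transpose] at this
  have h6 : normF E * normF E ≤ normF E * 0.001 :=
    mul_le_mul_of_nonneg_left (by linarith) hEF
  linarith

end CholeskyQR

/-! ### The shifted step -/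

/-- The data of the analysis of the shifted step: bounds for the column norms, the Frobenius norm
and the extreme singular values of `X`, and the conditions on the shift. -/
structure ShiftSetting (X : Matrix (Fin m) (Fin n) ℝ) (s F L N σ : ℝ) : Prop where
  size : SizeOK m n
  σ_pos : 0 < σ
  L_nonneg : 0 ≤ L
  s_eq : s = 11 * ((m + n + 1) * u) * F
  F_pos : 0 < F
  normF_le : normF X ^ 2 ≤ F
  col_le : ∀ j, ∑ i, X i j ^ 2 ≤ L ^ 2
  s_le_L : s ≤ L ^ 2 / 100
  s_le_N : s ≤ N ^ 2 / 100
  norm2_eq : norm2 X = N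
  lower : ∀ x, σ * vn x ≤ vn (X *ᵥ x)
  cap : 5.96 * (n ^ 2 * u * L) ≤ σ
  cond : 570 * (n * (m + n + 1) * u * s) ≤ σ ^ 2

variable {fl : ℝ → ℝ} {X : Matrix (Fin m) (Fin n) ℝ} {s F L N σ : ℝ}

namespace ShiftSetting

theorem s_pos (h : ShiftSetting X s F L N σ) : 0 < s := by
  rw [h.s_eq]
  have := u_pos
  have := h.F_pos
  positivity

theorem n_mul_s_le (h : ShiftSetting X s F L N σ) : n * s ≤ F / 100 := by
  have := mul_le_mul_of_nonneg_right h.size.small h.F_pos.le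
  rw [h.s_eq]
  linarith

theorem normF_one_le (n : ℕ) : normF (1 : Matrix (Fin n) (Fin n) ℝ) ≤ √n := by
  have h1 : norm2 (1 : Matrix (Fin n) (Fin n) ℝ) ≤ 1 :=
    norm2_le zero_le_one fun x => by rw [Matrix.one_mulVec, one_mul]
  have := mul_le_mul_of_nonneg_left h1 (Real.sqrt_nonneg (n : ℝ))
  linarith [normF_le_sqrt_mul (1 : Matrix (Fin n) (Fin n) ℝ)]

theorem normF_shift_le (hfl : IsRounding fl) (h : ShiftSetting X s F L N σ) :
    normF (flAddShift fl (flMul fl Xᵀ X) s - Xᵀ * X - s • 1) ≤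
      1.001 * (m * u) * F + 1.02 * u * F := by
  set B := flMul fl Xᵀ X
  set A := flAddShift fl B s
  have hs := h.s_pos
  have hu := u_pos
  have hF := h.F_pos
  have hG := normF_flMul_sub_le hfl Xᵀ X
  rw [normF_transpose, ← pow_two] at hG
  have hG1 : normF (B - Xᵀ * X) ≤ 1.001 * (m * u) * F :=
    hG.trans (mul_le_mul h.size.gam_m h.normF_le (sq_nonneg _) (by positivity))
  have hG2 : normF (B - Xᵀ * X) ≤ F / 2000 := by
    have := mul_le_mul h.size.gam_m_le h.normF_le (sq_nonneg _) (by positivity)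
    linarith
  have hD : normF (A - B - s • 1) ≤ u * (normF B + s * √n) := by
    have h1 : normF (A - B - s • 1) ≤ normF (u • absM (B + s • 1)) := by
      refine normF_mono fun i j => ?_
      by_cases hij : i = j
      · subst hij
        have := hfl (B i i + s)
        simpa [A, flAddShift, absM, sub_sub] using this
      · simp only [A, flAddShift, Matrix.sub_apply, Matrix.of_apply, if_neg hij, sub_self,
          Matrix.smul_apply, Matrix.one_apply_ne hij, smul_eq_mul, mul_zero, abs_zero, absM,
          Matrix.map_apply]
        exact mul_nonneg hu.le (abs_nonneg _)
    rw [normF_smul hu.le, normF_absM] at h1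
    refine h1.trans (mul_le_mul_of_nonneg_left ?_ hu.le)
    refine (normF_add_le _ _).trans (add_le_add_right ?_ _)
    rw [normF_smul hs.le]
    exact mul_le_mul_of_nonneg_left (normF_one_le n) hs.le
  have hB : normF B ≤ normF (B - Xᵀ * X) + F := by
    have h1 := normF_add_le (B - Xᵀ * X) (Xᵀ * X)
    rw [sub_add_cancel] at h1
    have h2 := normF_mul_le_normF_mul_normF Xᵀ X
    rw [normF_transpose, ← pow_two] at h2
    linarith [h.normF_le]
  have hsn : s * √n ≤ F / 100 := by
    have h1 : √(n : ℝ) ≤ n := by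
      have : (1 : ℝ) ≤ n := by exact_mod_cast (by have := h.size.two_le; omega : 1 ≤ n)
      exact Real.sqrt_le_iff.2 ⟨by positivity, by nlinarith⟩
    have := mul_le_mul_of_nonneg_left h1 hs.le
    linarith [h.n_mul_s_le]
  have h1 := normF_add_le (A - B - s • 1) (B - Xᵀ * X)
  rw [show A - B - s • 1 + (B - Xᵀ * X) = A - Xᵀ * X - s • 1 by abel] at h1
  have h2 := mul_le_mul_of_nonneg_left (by linarith : normF B + s * √n ≤ 1.02 * F) hu.le
  linarith

theorem diag_shift_le (hfl : IsRounding fl) (h : ShiftSetting X s F L N σ) (j : Fin n) :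
    flAddShift fl (flMul fl Xᵀ X) s j j ≤ 1.0006 * ((∑ i, X i j ^ 2) + s) := by
  have hs := h.s_pos
  have h1 := (abs_le.1 (abs_flMul_sub_le hfl Xᵀ X j j)).2
  have h1' := (abs_le.1 (abs_flMul_sub_le hfl Xᵀ X j j)).1
  have e : ∑ l, |Xᵀ j l * X l j| = ∑ i, X i j ^ 2 :=
    sum_congr rfl fun l _ => by
      rw [Matrix.transpose_apply, ← pow_two, abs_of_nonneg (sq_nonneg _)]
  have e2 : (Xᵀ * X) j j = ∑ i, X i j ^ 2 := by
    simp [Matrix.mul_apply, pow_two]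
  rw [e, Matrix.sub_apply, e2] at h1 h1'
  set S := ∑ i, X i j ^ 2
  have hS : 0 ≤ S := sum_nonneg fun _ _ => sq_nonneg _
  have hg := mul_le_mul_of_nonneg_right h.size.gam_m_le hS
  set b := flMul fl Xᵀ X j j with hb
  have h2 := (abs_le.1 (hfl (b + s))).2
  have hbs : 0 ≤ b + s := by linarith
  rw [abs_of_nonneg hbs] at h2
  have h3 := mul_le_mul_of_nonneg_right u_le hbs
  have h4 : flAddShift fl (flMul fl Xᵀ X) s j j = fl (b + s) := by simp [flAddShift, hb]
  rw [h4]
  linarith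

theorem trace_shift_le (hfl : IsRounding fl) (h : ShiftSetting X s F L N σ) :
    (flAddShift fl (flMul fl Xᵀ X) s).trace ≤ 1.011 * F := by
  have h1 : (flAddShift fl (flMul fl Xᵀ X) s).trace ≤
      ∑ j : Fin n, 1.0006 * ((∑ i, X i j ^ 2) + s) :=
    sum_le_sum fun j _ => h.diag_shift_le hfl j
  have h2 := normF_sq X
  rw [sum_comm] at h2
  rw [← mul_sum, sum_add_distrib, ← h2] at h1
  simp only [sum_const, card_univ, Fintype.card_fin, nsmul_eq_mul] at h1
  linarith [h.n_mul_s_le, h.normF_le, h.F_pos]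

/-- The bound by `F` is matched against the shift; this one, by the largest column, is what yields
the term with `l` in the residual. -/
theorem trace_shift_le' (hfl : IsRounding fl) (h : ShiftSetting X s F L N σ) :
    (flAddShift fl (flMul fl Xᵀ X) s).trace ≤ 1.011 * (n * L ^ 2) := by
  have h1 : (flAddShift fl (flMul fl Xᵀ X) s).trace ≤ ∑ j : Fin n, 1.011 * L ^ 2 := by
    refine sum_le_sum fun j _ => (h.diag_shift_le hfl j).trans ?_
    linarith [h.col_le j, h.s_le_L, sq_nonneg L]
  simp only [sum_const, card_univ, Fintype.card_fin, nsmul_eq_mul] at h1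
  linarith

/-- Absorbs the isolated multiples of `u` (rounding of the shift, the `+ 1` in `n + 1`) into the
slack between the error constants and `11/8`. -/
theorem size_five (h : ShiftSetting X s F L N σ) :
    5 * u ≤ (m + n + 1) * u := by
  have h1 : (2 : ℝ) ≤ n := by exact_mod_cast h.size.two_le
  have h2 : (n : ℝ) ≤ m := by exact_mod_cast h.size.le
  exact mul_le_mul_of_nonneg_right (by linarith) u_pos.le

theorem completes (hfl : IsRounding fl) (h : ShiftSetting X s F L N σ) :
    CholeskyCompletes fl (flAddShift fl (flMul fl Xᵀ X) s) := by
  have hs := h.s_pos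
  have hu := u_pos
  have hF := h.F_pos
  have hE := h.normF_shift_le hfl
  have h5 := mul_le_mul_of_nonneg_right h.size_five hF.le
  have p1 : 0 ≤ n * u * F := by positivity
  have p2 : 0 ≤ m * u * F := by positivity
  have hse := h.s_eq
  refine choleskyCompletes_of_lower_bound hfl (flAddShift_symm (flMul_transpose_self_symm X) s)
    (lam := 7 / 8 * s) (by positivity) (fun x => ?_) (by linarith [h.size.gam_n_succ_le]) ?_
  · set A := flAddShift fl (flMul fl Xᵀ X) s
    have h1 := abs_dot_mulVec_le (A - Xᵀ * X - s • 1) x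
    rw [Matrix.sub_mulVec, Matrix.sub_mulVec, Matrix.smul_mulVec, Matrix.one_mulVec,
      dotProduct_sub, dotProduct_sub, dotProduct_smul, ← vn_mulVec_sq, ← vn_sq_dot,
      smul_eq_mul] at h1
    have h2 := (abs_le.1 h1).1
    have h4 : normF (A - Xᵀ * X - s • 1) ≤ s / 8 := by linarith
    have h5 := mul_le_mul_of_nonneg_right h4 (sq_nonneg (vn x))
    linarith [sq_nonneg (vn (X *ᵥ x))]
  · have h1 := mul_le_mul_of_nonneg_left (h.trace_shift_le hfl) (gam_nonneg (n + 1))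
    have h2 := mul_le_mul_of_nonneg_right h.size.gam_n_succ hF.le
    have h3 := mul_le_mul_of_nonneg_right h.size.gam_n_succ_le hs.le
    have p3 : 0 < u * F := by positivity
    linarith

theorem normF_cholesky_sq_le (hfl : IsRounding fl) (h : ShiftSetting X s F L N σ) :
    normF (sCholeskyQR fl s X).2 ^ 2 ≤ 1.012 * F := by
  have h1 := (SparseCholQR.normF_cholesky_sq_le hfl (h.completes hfl)).trans
    (h.trace_shift_le hfl)
  simp only [sCholeskyQR]
  have h3 := mul_le_mul_of_nonneg_right h.size.gam_n_succ_le
    (sq_nonneg (normF (flCholesky fl (flAddShift fl (flMul fl Xᵀ X) s))))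
  linarith [h.F_pos]

theorem normF_cholesky_le (hfl : IsRounding fl) (h : ShiftSetting X s F L N σ) :
    normF (sCholeskyQR fl s X).2 ≤ 1.007 * (√n * L) := by
  have h1 := (SparseCholQR.normF_cholesky_sq_le hfl (h.completes hfl)).trans
    (h.trace_shift_le' hfl)
  simp only [sCholeskyQR]
  have h3 := mul_le_mul_of_nonneg_right h.size.gam_n_succ_le
    (sq_nonneg (normF (flCholesky fl (flAddShift fl (flMul fl Xᵀ X) s))))
  have h4 : 0 ≤ n * L ^ 2 := by positivity
  have hL := h.L_nonneg
  refine le_of_sq_le_sq ?_ (by positivity)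
  rw [mul_pow, mul_pow, Real.sq_sqrt (Nat.cast_nonneg n)]
  linarith

theorem vn_cholesky_sq (hfl : IsRounding fl) (h : ShiftSetting X s F L N σ) (x : Fin n → ℝ) :
    |vn ((sCholeskyQR fl s X).2 *ᵥ x) ^ 2 - vn (X *ᵥ x) ^ 2 - s * vn x ^ 2| ≤
      s / 8 * vn x ^ 2 := by
  refine vn_sq_sub_le ?_ x
  have hc := h.completes hfl
  have hF := h.F_pos
  have hu := u_pos
  have h1 := h.normF_cholesky_sq_le hfl
  have h2 := SparseCholQR.normF_cholesky_sub_le hfl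
    (flAddShift_symm (flMul_transpose_self_symm X) s) hc
  have h3 := h.normF_shift_le hfl
  simp only [sCholeskyQR] at h1 ⊢
  set A := flAddShift fl (flMul fl Xᵀ X) s
  set Y := flCholesky fl A
  have h4 := normF_add_le (Yᵀ * Y - A) (A - Xᵀ * X - s • 1)
  rw [show Yᵀ * Y - A + (A - Xᵀ * X - s • 1) = Yᵀ * Y - Xᵀ * X - s • 1 by abel] at h4
  have h5 := mul_le_mul h.size.gam_n_succ h1 (sq_nonneg _) (by positivity)
  have h6 := mul_le_mul_of_nonneg_right h.size_five hF.le
  have p1 : 0 ≤ n * u * F := by positivity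
  have p2 : 0 ≤ m * u * F := by positivity
  have hse := h.s_eq
  linarith

theorem vn_le_cholesky (hfl : IsRounding fl) (h : ShiftSetting X s F L N σ) (x : Fin n → ℝ) :
    vn (X *ᵥ x) ≤ 1 * vn ((sCholeskyQR fl s X).2 *ᵥ x) := by
  have h1 := (abs_le.1 (h.vn_cholesky_sq hfl x)).1
  have h2 := mul_nonneg h.s_pos.le (sq_nonneg (vn x))
  rw [one_mul]
  exact le_of_sq_le_sq (by linarith) (vn_nonneg _)

theorem cholesky_lower (hfl : IsRounding fl) (h : ShiftSetting X s F L N σ) (x : Fin n → ℝ) :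
    √(7 / 8 * s) * vn x ≤ vn ((sCholeskyQR fl s X).2 *ᵥ x) := by
  have h1 := (abs_le.1 (h.vn_cholesky_sq hfl x)).1
  have hs := h.s_pos
  refine le_of_sq_le_sq ?_ (vn_nonneg _)
  rw [mul_pow, Real.sq_sqrt (by positivity)]
  linarith [sq_nonneg (vn (X *ᵥ x))]

theorem norm2_cholesky_le (hfl : IsRounding fl) (h : ShiftSetting X s F L N σ) :
    norm2 (sCholeskyQR fl s X).2 ≤ 1.006 * N := by
  have hN : 0 ≤ N := h.norm2_eq ▸ norm2_nonneg X
  refine norm2_le (by positivity) fun x => ?_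
  have h1 := (abs_le.1 (h.vn_cholesky_sq hfl x)).2
  have h2 := pow_le_pow_left₀ (vn_nonneg _) (vn_mulVec_le X x) 2
  have h3 := mul_le_mul_of_nonneg_right h.s_le_N (sq_nonneg (vn x))
  rw [h.norm2_eq, mul_pow] at h2
  have h4 : 0 ≤ N ^ 2 * vn x ^ 2 := by positivity
  refine le_of_sq_le_sq ?_ (mul_nonneg (by positivity) (vn_nonneg _))
  rw [mul_pow, mul_pow]
  linarith

/-- The relative error of the triangular solves is small compared with the shift. -/
theorem gam_mul_le (hfl : IsRounding fl) (h : ShiftSetting X s F L N σ) :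
    gam n * (√n * normF (sCholeskyQR fl s X).2) ≤ 0.006 * √(7 / 8 * s) := by
  have hs := h.s_pos
  have hu := u_pos
  have hF := h.F_pos
  have hn : (0 : ℝ) ≤ n := Nat.cast_nonneg _
  refine le_of_sq_le_sq ?_ (by positivity)
  rw [mul_pow, mul_pow, mul_pow, Real.sq_sqrt hn, Real.sq_sqrt (by positivity)]
  have h1 := pow_le_pow_left₀ (gam_nonneg n) h.size.gam_n 2
  have h2 := mul_le_mul_of_nonneg_left (h.normF_cholesky_sq_le hfl) hn
  have h3 := mul_le_mul h1 h2 (by positivity) (by positivity)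
  refine h3.trans ?_
  -- After squaring, the left side is about `(n² u)(n u) F`: the first factor is small and `2 n u ≤
  -- a`, where `a F = s / 11`.
  have h4 : n ^ 2 * u ≤ 1 / 2200 := by linarith [h.size.sq_le, h.size.small]
  have h5 : 2 * n * u ≤ (m + n + 1) * u := by
    have : (n : ℝ) ≤ m := by exact_mod_cast h.size.le
    exact mul_le_mul_of_nonneg_right (by linarith) hu.le
  have h6 := mul_le_mul h4 h5 (by positivity) (by norm_num)
  have h7 := mul_le_mul_of_nonneg_right h6 hF.le
  have p : 0 ≤ (m + n + 1) * u * F := by positivity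
  rw [h.s_eq]
  calc (1.001 * (n * u)) ^ 2 * (n * (1.012 * F)) =
        1.001 ^ 2 * 1.012 / 2 * (n ^ 2 * u * (2 * n * u) * F) := by ring
    _ ≤ 1.001 ^ 2 * 1.012 / 2 * (1 / 2200 * ((m + n + 1) * u) * F) :=
        mul_le_mul_of_nonneg_left h7 (by norm_num)
    _ ≤ 0.006 ^ 2 * (7 / 8 * (11 * ((m + n + 1) * u) * F)) := by linarith

theorem solve_backward (hfl : IsRounding fl) (h : ShiftSetting X s F L N σ) :
    normF ((sCholeskyQR fl s X).1 * (sCholeskyQR fl s X).2 - X) ≤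
      gam n * (normF (sCholeskyQR fl s X).1 * normF (sCholeskyQR fl s X).2) :=
  normF_flSolve_cholesky_le hfl (h.completes hfl) X

theorem norm2_solve_le (hfl : IsRounding fl) (h : ShiftSetting X s F L N σ) :
    norm2 (sCholeskyQR fl s X).1 ≤ 1.01 := by
  have hs := h.s_pos
  have := SparseCholQR.norm2_solve_le (gam_nonneg n) (Real.sqrt_pos.2 (by positivity)) zero_le_one
    (by norm_num) (h.cholesky_lower hfl) (h.vn_le_cholesky hfl) (h.solve_backward hfl)
    (h.gam_mul_le hfl)
  linarith

theorem backward (hfl : IsRounding fl) (h : ShiftSetting X s F L N σ) :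
    normF ((sCholeskyQR fl s X).1 * (sCholeskyQR fl s X).2 - X) ≤ 1.02 * (n ^ 2 * u * L) := by
  have hu := u_pos
  have hL := h.L_nonneg
  have h0 := Real.sqrt_nonneg (n : ℝ)
  have h1 := (normF_le_sqrt_mul (sCholeskyQR fl s X).1).trans
    (mul_le_mul_of_nonneg_left (h.norm2_solve_le hfl) h0)
  have h2 := mul_le_mul h1 (h.normF_cholesky_le hfl) (normF_nonneg _) (by positivity)
  have h3 := mul_le_mul h.size.gam_n h2 (mul_nonneg (normF_nonneg _) (normF_nonneg _))
    (by positivity)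
  refine (h.solve_backward hfl).trans (h3.trans ?_)
  have e : 1.001 * (n * u) * (√n * 1.01 * (1.007 * (√n * L))) =
      1.001 * 1.01 * 1.007 * (√n ^ 2 * n * u * L) := by ring
  have p : 0 ≤ n ^ 2 * u * L := by positivity
  rw [e, Real.sq_sqrt (Nat.cast_nonneg n)]
  linarith

/-- The lower bound for the smallest singular value of the first computed factor. -/
noncomputable def sigmaW (s σ : ℝ) : ℝ := 0.82 * √(σ ^ 2 / (σ ^ 2 + 9 / 8 * s))

theorem sigmaW_sq (h : ShiftSetting X s F L N σ) :
    sigmaW s σ ^ 2 = 0.82 ^ 2 * (σ ^ 2 / (σ ^ 2 + 9 / 8 * s)) := by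
  have := h.s_pos
  rw [sigmaW, mul_pow, Real.sq_sqrt (by positivity)]

theorem sigmaW_pos (h : ShiftSetting X s F L N σ) : 0 < sigmaW s σ := by
  have := h.s_pos
  have := h.σ_pos
  unfold sigmaW
  positivity

theorem sigmaW_le (h : ShiftSetting X s F L N σ) : sigmaW s σ ≤ 1 := by
  have := h.s_pos
  have := h.σ_pos
  have h1 : √(σ ^ 2 / (σ ^ 2 + 9 / 8 * s)) ≤ 1 := by
    rw [Real.sqrt_le_one, div_le_one (by positivity)]
    linarith
  unfold sigmaW
  linarith

/-- The ratio `‖Xx‖² / (‖Xx‖² + 9/8 s ‖x‖²)` increases with `‖Xx‖ / ‖x‖`, hence is least at `σ`. The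
factor `0.82 = 1 - 0.18` pays for the substitution, whose error is at most `1.02 / 5.96 < 0.18`
times `σ`. -/
theorem solve_lower (hfl : IsRounding fl) (h : ShiftSetting X s F L N σ) (z : Fin n → ℝ) :
    sigmaW s σ * vn z ≤ vn ((sCholeskyQR fl s X).1 *ᵥ z) := by
  have hs := h.s_pos
  have hσ := h.σ_pos
  have := SparseCholQR.solve_lower_bound (η := 0.18) (ν := √(σ ^ 2 / (σ ^ 2 + 9 / 8 * s)))
    (Real.sqrt_pos.2 (by positivity)) (by norm_num) (by norm_num) (h.cholesky_lower hfl) h.lower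
    (fun x => ?_) (?_ : normF ((sCholeskyQR fl s X).1 * (sCholeskyQR fl s X).2 - X) ≤ _) z
  · unfold sigmaW
    linarith
  · refine le_of_sq_le_sq ?_ (vn_nonneg _)
    rw [mul_pow, Real.sq_sqrt (by positivity), div_mul_eq_mul_div, div_le_iff₀ (by positivity)]
    have h1 := (abs_le.1 (h.vn_cholesky_sq hfl x)).2
    have h2 := pow_le_pow_left₀ (mul_nonneg hσ.le (vn_nonneg x)) (h.lower x) 2
    rw [mul_pow] at h2
    have h3 := mul_le_mul_of_nonneg_left h1 (sq_nonneg σ)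
    have h4 := mul_le_mul_of_nonneg_left h2 hs.le
    linarith
  · have := h.cap
    have := h.backward hfl
    linarith

/-- After clearing denominators, `θ ≤ 1/1100` handles the `σ²` part and `cond` the `s` part:
`200/1100 + 225/570 < 0.82²`. -/
theorem theta_le (h : ShiftSetting X s F L N σ) :
    n * (m + n + 1) * u ≤ sigmaW s σ ^ 2 / 200 := by
  have hs := h.s_pos
  have hσ := h.σ_pos
  have hσ2 : 0 < σ ^ 2 := by positivity
  rw [h.sigmaW_sq, mul_div_assoc', div_div, le_div_iff₀ (by positivity)]
  have h1 := mul_le_mul_of_nonneg_right h.size.small hσ2.le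
  have h2 := h.cond
  linarith

theorem normF_sq_le_of_norm2_le {W : Matrix (Fin m) (Fin n) ℝ} (h : norm2 W ≤ 1.01) :
    normF W ^ 2 ≤ 1.03 * n := by
  have h1 := pow_le_pow_left₀ (normF_nonneg W) (normF_le_sqrt_mul W) 2
  rw [mul_pow, Real.sq_sqrt (Nat.cast_nonneg n)] at h1
  have h2 := mul_le_mul_of_nonneg_left (pow_le_pow_left₀ (norm2_nonneg W) h 2)
    (Nat.cast_nonneg (α := ℝ) n)
  have : (0 : ℝ) ≤ n := Nat.cast_nonneg n
  linarith

theorem completes_second (hfl : IsRounding fl) (h : ShiftSetting X s F L N σ) :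
    CholeskyCompletes fl (flMul fl (sCholeskyQR fl s X).1ᵀ (sCholeskyQR fl s X).1) :=
  choleskyQR_completes hfl h.size h.sigmaW_pos (h.solve_lower hfl)
    (normF_sq_le_of_norm2_le (h.norm2_solve_le hfl)) h.theta_le

theorem bounds_second (hfl : IsRounding fl) (h : ShiftSetting X s F L N σ) :
    CholeskyQRBounds (sCholeskyQR fl s X).1 (choleskyQR fl (sCholeskyQR fl s X).1).1
      (choleskyQR fl (sCholeskyQR fl s X).1).2 :=
  (choleskyQR_bounds hfl h.size h.sigmaW_pos (h.sigmaW_le.trans (by norm_num))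
    (h.solve_lower hfl) (normF_sq_le_of_norm2_le (h.norm2_solve_le hfl)) h.theta_le
    (h.completes_second hfl)).1

theorem completes_third (hfl : IsRounding fl) (h : ShiftSetting X s F L N σ) :
    CholeskyCompletes fl (flMul fl (choleskyQR fl (sCholeskyQR fl s X).1).1ᵀ
      (choleskyQR fl (sCholeskyQR fl s X).1).1) :=
  choleskyQR_completes hfl h.size (by norm_num) (h.bounds_second hfl).lower_W
    (normF_sq_le_of_norm2_le ((h.bounds_second hfl).norm2_W.trans (by norm_num)))
    (h.size.small.trans (by norm_num))

theorem bounds_third (hfl : IsRounding fl) (h : ShiftSetting X s F L N σ) :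
    CholeskyQRBounds (choleskyQR fl (sCholeskyQR fl s X).1).1
        (choleskyQR fl (choleskyQR fl (sCholeskyQR fl s X).1).1).1
        (choleskyQR fl (choleskyQR fl (sCholeskyQR fl s X).1).1).2 ∧
      ∀ x, 0.997 * vn ((choleskyQR fl (sCholeskyQR fl s X).1).1 *ᵥ x) ≤
        vn ((choleskyQR fl (choleskyQR fl (sCholeskyQR fl s X).1).1).2 *ᵥ x) :=
  choleskyQR_bounds hfl h.size (by norm_num) (by norm_num) (h.bounds_second hfl).lower_W
    (normF_sq_le_of_norm2_le ((h.bounds_second hfl).norm2_W.trans (by norm_num)))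
    (h.size.small.trans (by norm_num)) (h.completes_third hfl)

theorem orthogonality (hfl : IsRounding fl) (h : ShiftSetting X s F L N σ) :
    normF ((sCholeskyQR3 fl s X).1ᵀ * (sCholeskyQR3 fl s X).1 - 1) ≤
      3 * (n * (m + n + 1) * u) :=
  choleskyQR_orthogonality hfl h.size (h.bounds_second hfl).lower_W (h.bounds_second hfl).norm2_W
    (h.completes_third hfl)
    (normF_sq_le_of_norm2_le ((h.bounds_second hfl).norm2_W.trans (by norm_num)))
    (h.bounds_third hfl).1 (h.bounds_third hfl).2

theorem norm2_le_of_vn_le {A : Matrix (Fin m) (Fin n) ℝ} {R : Matrix (Fin n) (Fin n) ℝ} {c b : ℝ}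
    (hc : 0 ≤ c) (hA : norm2 A ≤ b) (h : ∀ x, vn (R *ᵥ x) ≤ c * vn (A *ᵥ x)) :
    norm2 R ≤ c * b :=
  norm2_le (mul_nonneg hc ((norm2_nonneg A).trans hA)) fun x => by
    have h1 := mul_le_mul_of_nonneg_left
      ((vn_mulVec_le A x).trans (mul_le_mul_of_nonneg_right hA (vn_nonneg x))) hc
    linarith [h x]

/-- Telescoping: three substitutions and two matrix products contribute one backward error each,
multiplied by factors that are already bounded. -/
theorem residual_decomposition (X W V Q : Matrix (Fin m) (Fin n) ℝ)
    (Y D J Z R : Matrix (Fin n) (Fin n) ℝ) :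
    Q * R - X = (W * Y - X) + ((V * D - W) * Y + ((Q * J - V) * D * Y +
      (Q * (Z - J * D) * Y + Q * (R - Z * Y)))) := by
  simp only [Matrix.sub_mul, Matrix.mul_sub, Matrix.mul_assoc]
  abel

theorem residual (hfl : IsRounding fl) (h : ShiftSetting X s F L N σ) :
    normF ((sCholeskyQR3 fl s X).1 * (sCholeskyQR3 fl s X).2 - X) ≤
      3.14 * (n ^ 2 * u * N) + 2.1 * (n ^ 2 * u * L) := by
  have hu := u_pos
  have hL := h.L_nonneg
  have hN : 0 ≤ N := h.norm2_eq ▸ norm2_nonneg X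
  have hsq : √(n : ℝ) ^ 2 = n := Real.sq_sqrt (Nat.cast_nonneg n)
  have hn1 : (1 : ℝ) ≤ √n := by
    have : (2 : ℝ) ≤ n := by exact_mod_cast h.size.two_le
    rw [Real.one_le_sqrt]
    linarith
  have e1 := h.backward hfl
  have hY := h.norm2_cholesky_le hfl
  have hYF := h.normF_cholesky_le hfl
  have hW := h.norm2_solve_le hfl
  have b2 := h.bounds_second hfl
  have b3 := (h.bounds_third hfl).1
  simp only [sCholeskyQR3, choleskyQR2]
  set W := (sCholeskyQR fl s X).1
  set Y := (sCholeskyQR fl s X).2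
  set V := (choleskyQR fl W).1
  set D := (choleskyQR fl W).2
  set Q := (choleskyQR fl V).1
  set J := (choleskyQR fl V).2
  have e4 := normF_flMul_sub_le hfl J D
  have e5 := normF_flMul_sub_le hfl (flMul fl J D) Y
  set Z := flMul fl J D
  set R := flMul fl Z Y
  have hD : norm2 D ≤ 1.003 * 1.01 := norm2_le_of_vn_le (by norm_num) hW b2.vn_R
  have hJ : norm2 J ≤ 1.003 * 1.006 := norm2_le_of_vn_le (by norm_num) b2.norm2_W b3.vn_R
  set T := n ^ 2 * u with hT
  have hT0 : 0 ≤ T := by positivity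
  have hT1 : T ≤ 1 / 2200 := by linarith [h.size.sq_le, h.size.small]
  have hTN := mul_nonneg hT0 hN
  have hTL := mul_nonneg hT0 hL
  have f4 : normF (Z - J * D) ≤ 1.038 * T := by
    have h1 := mul_le_mul b3.normF_R b2.normF_R (normF_nonneg _) (by positivity)
    have h2 := mul_le_mul h.size.gam_n h1 (mul_nonneg (normF_nonneg _) (normF_nonneg _))
      (by positivity)
    have : 1.001 * (n * u) * (1.018 * √n * (1.018 * √n)) =
      1.001 * 1.018 ^ 2 * (√n ^ 2 * n * u) := by ring
    rw [this, hsq, ← pow_two, ← hT] at h2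
    linarith
  have hZ : normF Z ≤ 1.03 * √n := by
    have h1 := normF_add_le (Z - J * D) (J * D)
    rw [sub_add_cancel] at h1
    have h2 := (normF_mul_le J D).trans (mul_le_mul hJ b2.normF_R (normF_nonneg _) (by norm_num))
    linarith
  have f5 : normF (R - Z * Y) ≤ 1.04 * (T * L) := by
    have h1 := mul_le_mul hZ hYF (normF_nonneg _) (by positivity)
    have h2 := mul_le_mul h.size.gam_n h1 (mul_nonneg (normF_nonneg _) (normF_nonneg _))
      (by positivity)
    have : 1.001 * (n * u) * (1.03 * √n * (1.007 * (√n * L))) =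
      1.001 * 1.03 * 1.007 * (√n ^ 2 * n * u * L) := by ring
    rw [this, hsq, ← pow_two, ← hT] at h2
    linarith
  have g2 : normF ((V * D - W) * Y) ≤ 1.027 * T * (1.006 * N) :=
    (normF_mul_le' _ _).trans (mul_le_mul b2.backward hY (norm2_nonneg _) (by positivity))
  have g3 : normF ((Q * J - V) * D * Y) ≤ 1.027 * T * (1.003 * 1.01) * (1.006 * N) := by
    refine (normF_mul_le' _ _).trans (mul_le_mul ?_ hY (norm2_nonneg _) (by positivity))
    exact (normF_mul_le' _ _).trans (mul_le_mul b3.backward hD (norm2_nonneg _) (by positivity))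
  have g4 : normF (Q * (Z - J * D) * Y) ≤ 1.006 * (1.038 * T) * (1.006 * N) := by
    refine (normF_mul_le' _ _).trans (mul_le_mul ?_ hY (norm2_nonneg _) (by positivity))
    exact (normF_mul_le _ _).trans (mul_le_mul b3.norm2_W f4 (normF_nonneg _) (by norm_num))
  have g5 : normF (Q * (R - Z * Y)) ≤ 1.006 * (1.04 * (T * L)) :=
    (normF_mul_le _ _).trans (mul_le_mul b3.norm2_W f5 (normF_nonneg _) (by norm_num))
  rw [residual_decomposition X W V Q Y D J Z R]
  have t1 := normF_add_le (W * Y - X) ((V * D - W) * Y + ((Q * J - V) * D * Y +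
      (Q * (Z - J * D) * Y + Q * (R - Z * Y))))
  have t2 := normF_add_le ((V * D - W) * Y) ((Q * J - V) * D * Y +
      (Q * (Z - J * D) * Y + Q * (R - Z * Y)))
  have t3 := normF_add_le ((Q * J - V) * D * Y) (Q * (Z - J * D) * Y + Q * (R - Z * Y))
  have t4 := normF_add_le (Q * (Z - J * D) * Y) (Q * (R - Z * Y))
  linarith

theorem rank_solve (hfl : IsRounding fl) (h : ShiftSetting X s F L N σ) :
    (sCholeskyQR fl s X).1.rank = n :=
  rank_eq_of_lower_bound h.sigmaW_pos (h.solve_lower hfl)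

theorem kappa2_solve (hfl : IsRounding fl) (h : ShiftSetting X s F L N σ) :
    8 * kappa2 (sCholeskyQR fl s X).1 * √(n * (m + n + 1) * u) ≤ 1 := by
  have hσ := h.sigmaW_pos
  have h1 : sigmaW s σ ≤ sigmaMin (sCholeskyQR fl s X).1 :=
    le_sigmaMin (by have := h.size.two_le; omega) (h.solve_lower hfl)
  have h2 : √(n * (m + n + 1) * u) ≤ 0.071 * sigmaW s σ := by
    rw [Real.sqrt_le_left (by positivity), mul_pow]
    nlinarith [h.theta_le]
  have h3 := h.norm2_solve_le hfl
  have h4 : kappa2 (sCholeskyQR fl s X).1 ≤ 1.01 / sigmaW s σ :=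
    div_le_div₀ (by norm_num) h3 hσ h1
  have h5 := mul_le_mul h4 h2 (Real.sqrt_nonneg _) (by positivity)
  have h6 : 1.01 / sigmaW s σ * (0.071 * sigmaW s σ) = 1.01 * 0.071 := by field_simp
  linarith

end ShiftSetting

/-! ### Sparse matrices -/

section Sparse

variable {X : Matrix (Fin m) (Fin n) ℝ} {v t₁ t₂ : ℕ}

theorem abs_le_maxAbs (X : Matrix (Fin m) (Fin n) ℝ) (i : Fin m) (j : Fin n) :
    |X i j| ≤ maxAbs X :=
  le_ciSup (f := fun ij : Fin m × Fin n => |X ij.1 ij.2|) (Set.finite_range _).bddAbove (i, j)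

theorem sum_sq_col_le (X : Matrix (Fin m) (Fin n) ℝ) (j : Fin n) :
    ∑ i, X i j ^ 2 ≤ colNnz X j * maxAbs X ^ 2 := by
  have h1 : ∑ i, X i j ^ 2 = ∑ i ∈ univ.filter fun i => X i j ≠ 0, X i j ^ 2 := by
    rw [sum_filter]
    exact sum_congr rfl fun i _ => by split_ifs with h <;> simp_all
  rw [h1, colNnz, ← nsmul_eq_mul]
  refine sum_le_card_nsmul _ _ _ fun i _ => ?_
  rw [← sq_abs (X i j)]
  exact pow_le_pow_left₀ (abs_nonneg _) (abs_le_maxAbs X i j) 2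

theorem IsT1.sum_sq_col_le (hX : IsT1 X v t₁ t₂) (j : Fin n) :
    ∑ i, X i j ^ 2 ≤ t₁ * maxAbs X ^ 2 := by
  obtain ⟨D, -, hD, hD'⟩ := hX.exists_dense
  refine (SparseCholQR.sum_sq_col_le X j).trans (mul_le_mul_of_nonneg_right ?_ (sq_nonneg _))
  have h : colNnz X j ≤ t₁ := by
    by_cases hj : j ∈ D
    · exact hD j hj
    · exact (hD' j hj).trans hX.t₂_lt.le
  exact_mod_cast h

theorem IsT1.normF_sq_le (hX : IsT1 X v t₁ t₂) :
    normF X ^ 2 ≤ (v * t₁ + n * t₂) * maxAbs X ^ 2 := by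
  obtain ⟨D, hcard, hD, hD'⟩ := hX.exists_dense
  rw [normF_sq, sum_comm]
  refine (sum_le_sum fun j _ => SparseCholQR.sum_sq_col_le X j).trans ?_
  rw [← sum_mul]
  refine mul_le_mul_of_nonneg_right ?_ (sq_nonneg _)
  -- The `n - v` sparse columns are counted as `n`, in accordance with the form of the shift.
  have h : ∑ j, colNnz X j ≤ v * t₁ + n * t₂ := by
    rw [← sum_add_sum_compl D]
    refine add_le_add ?_ ?_
    · rw [← hcard, ← smul_eq_mul]
      exact sum_le_card_nsmul _ _ _ hD
    · refine (sum_le_card_nsmul Dᶜ _ t₂ fun j hj => hD' j (mem_compl.1 hj)).trans ?_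
      rw [smul_eq_mul]
      exact Nat.mul_le_mul_right _ ((card_le_univ _).trans_eq (Fintype.card_fin n))
  exact_mod_cast h

theorem vn_col_le_norm2 (X : Matrix (Fin m) (Fin n) ℝ) (j : Fin n) : vn (X.col j) ≤ norm2 X := by
  have := vn_mulVec_le X (Pi.single j 1)
  rwa [vn_single, mul_one, Matrix.mulVec_single_one] at this

theorem gNorm_nonneg (X : Matrix (Fin m) (Fin n) ℝ) : 0 ≤ gNorm X :=
  Real.iSup_nonneg fun _ => Real.sqrt_nonneg _

theorem gNorm_le_norm2 (hn : 0 < n) (X : Matrix (Fin m) (Fin n) ℝ) : gNorm X ≤ norm2 X := by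
  have : Nonempty (Fin n) := ⟨⟨0, hn⟩⟩
  refine ciSup_le fun j => ?_
  have h := vn_sq (X.col j)
  rw [show ∑ i, X i j ^ 2 = vn (X.col j) ^ 2 from h.symm, Real.sqrt_sq (vn_nonneg _)]
  exact vn_col_le_norm2 X j

end Sparse

/-! ### The factor `h` and the main theorem -/

theorem le_hFactor (m n v : ℕ) : 1.49 ≤ hFactor m n v := by
  refine Real.le_sqrt_of_sq_le ?_
  have : 0 ≤ rRatio m n v := by unfold rRatio; positivity
  nlinarith

/-- Not a consequence of `1.49 ≤ h` that would do: `cond` needs `256 h² ≥ 570`, and `256 · 1.49²`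
falls short of it. -/
theorem le_hFactor_sq (m n v : ℕ) : 2.23 ≤ hFactor m n v ^ 2 := by
  have : 0 ≤ rRatio m n v := by unfold rRatio; positivity
  rw [hFactor, Real.sq_sqrt (by positivity)]
  nlinarith

theorem IsT1.two_le {X : Matrix (Fin m) (Fin n) ℝ} {v t₁ t₂ : ℕ} (hX : IsT1 X v t₁ t₂) : 2 ≤ n := by
  have := hX.v_pos
  have := hX.v_lt
  omega

end SparseCholQR

theorem mainTheorem3 {m n : ℕ} (X : Matrix (Fin m) (Fin n) ℝ) (v t₁ t₂ : ℕ) (β : ℝ)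
    (hX : SparseCholQR.IsT1 X v t₁ t₂) (hrank : X.rank = n)
    (hc : SparseCholQR.maxAbs X = √(β / m) * SparseCholQR.norm2 X)
    (hβ : β ≤ m * n * SparseCholQR.pRatio X ^ 2 / (v * t₁ + n * t₂)) :
    SparseCholQR.jS X v t₁ t₂ =
        11 * (m * SparseCholQR.u + (n + 1) * SparseCholQR.u) *
          ((v * t₁ + n * t₂) * SparseCholQR.maxAbs X ^ 2) ∧
      (v * t₁ + n * t₂) * SparseCholQR.maxAbs X ^ 2 / SparseCholQR.norm2 X ^ 2 =
        β * (v * t₁ + n * t₂) / m ∧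
      ∀ fl : ℝ → ℝ, SparseCholQR.IsRounding fl →
        SparseCholQR.GeneralSettings X v t₁ t₂ (SparseCholQR.jS X v t₁ t₂) →
        SparseCholQR.kappa2 X ≤
          1 / (16 * √(11 * n * (β * (v * t₁ + n * t₂) / m)) *
            (m * SparseCholQR.u + (n + 1) * SparseCholQR.u) * SparseCholQR.hFactor m n v) →
        SparseCholQR.SCholeskyQR3Works fl (SparseCholQR.jS X v t₁ t₂) X v t₁ := by
  open SparseCholQR in
  have hn2 := hX.two_le
  have hn0 : 0 < n := by omega
  have ht1 : 0 < t₁ := hX.t₂_pos.trans hX.t₂_lt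
  have hm0 : 0 < m := ht1.trans_le hX.t₁_le
  have hnR : (0 : ℝ) < n := by exact_mod_cast hn0
  have hmR : (0 : ℝ) < m := by exact_mod_cast hm0
  have ht1R : (0 : ℝ) < t₁ := by exact_mod_cast ht1
  have ht2R : (0 : ℝ) < t₂ := by exact_mod_cast hX.t₂_pos
  have hu := u_pos
  have hσ := sigmaMin_pos hn0 hrank
  have hlow := sigmaMin_mul_vn_le hn0 X
  have hcol : sigmaMin X ≤ vn (X.col ⟨0, hn0⟩) := by
    have := hlow (Pi.single ⟨0, hn0⟩ 1)
    rwa [vn_single, mul_one, Matrix.mulVec_single_one] at this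
  have hN : 0 < norm2 X := hσ.trans_le (hcol.trans (vn_col_le_norm2 X _))
  have hmax : 0 < maxAbs X := by
    have h1 := pow_pos (hσ.trans_le hcol) 2
    rw [vn_sq] at h1
    have h2 := h1.trans_le (hX.sum_sq_col_le ⟨0, hn0⟩)
    refine lt_of_le_of_ne (Real.iSup_nonneg fun _ => abs_nonneg _) fun h0 => ?_
    rw [← h0] at h2
    simp at h2
  -- The sign of `β` comes from `c > 0`: the square root of a non-positive number is 0.
  have hβm : 0 < β / m := by
    refine Real.sqrt_pos.1 ?_
    rw [hc] at hmax
    exact pos_of_mul_pos_left hmax hN.le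
  have hc2 : maxAbs X ^ 2 = β / m * norm2 X ^ 2 := by
    rw [hc, mul_pow, Real.sq_sqrt hβm.le]
  set K : ℝ := v * t₁ + n * t₂ with hK
  have hK0 : 0 < K := by positivity
  set F := K * maxAbs X ^ 2 with hF
  have hF0 : 0 < F := by positivity
  have hFN : F = β * K / m * norm2 X ^ 2 := by rw [hF, hc2]; ring
  have hFg : F ≤ n * gNorm X ^ 2 := by
    rw [le_div_iff₀ hK0] at hβ
    have h1 : β * K / m ≤ n * pRatio X ^ 2 := by
      rw [div_le_iff₀ hmR]; linarith
    have h2 := mul_le_mul_of_nonneg_right h1 (sq_nonneg (norm2 X))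
    have h3 : pRatio X ^ 2 * norm2 X ^ 2 = gNorm X ^ 2 := by
      rw [← mul_pow, pRatio, div_mul_cancel₀ _ hN.ne']
    rw [hFN]
    linarith [congrArg (fun y => (n : ℝ) * y) h3]
  have hjs : jS X v t₁ t₂ = altShift X v t₁ t₂ := by
    refine min_eq_left ?_
    unfold altShift gShift
    rw [← hK, ← hF]
    have := mul_le_mul_of_nonneg_left hFg
      (by positivity : 0 ≤ 11 * (m * u + (n + 1) * u))
    linarith
  have hjs' : jS X v t₁ t₂ = 11 * (m * u + (n + 1) * u) * F := hjs
  refine ⟨hjs', by rw [hFN]; field_simp, fun fl hfl hG hκ => ?_⟩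
  have hjB := hG.le_jB
  have hcap := hG.kappa2_le
  rw [jB, if_pos hjs, phi, ← hK, ← hF] at hjB
  rw [kappaCap, if_pos hjs] at hcap
  have hsF := hjB.trans (min_le_left _ _)
  have hsL := hjB.trans (min_le_right _ _)
  set s := jS X v t₁ t₂
  set a := (m + n + 1) * u with ha
  have ha0 : 0 < a := by positivity
  have hs11 : s = 11 * a * F := by rw [hjs']; ring
  have hna : n * (m + n + 1) * u = n * a := by ring
  have hL2 : (maxAbs X * √t₁) ^ 2 = t₁ * maxAbs X ^ 2 := by
    rw [mul_pow, Real.sq_sqrt ht1R.le, mul_comm]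
  have hh := le_hFactor m n v
  have hset : ShiftSetting X s F (maxAbs X * √t₁) (norm2 X) (sigmaMin X) :=
    { size := ⟨hn2, ?_, ?_⟩
      σ_pos := hσ
      L_nonneg := by positivity
      s_eq := hs11
      F_pos := hF0
      normF_le := hX.normF_sq_le
      col_le := fun j => hL2 ▸ hX.sum_sq_col_le j
      s_le_L := by rw [hL2]; linarith
      s_le_N := ?_
      norm2_eq := rfl
      lower := hlow
      cap := ?_
      cond := ?_ }
  · refine ⟨⟨hset.completes hfl, hset.completes_second hfl, hset.completes_third hfl⟩,
      hset.rank_solve hfl, ?_, ?_, ?_⟩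
    · have := hset.kappa2_solve hfl
      rwa [show (m * n * u + n * (n + 1) * u : ℝ) = n * (m + n + 1) * u by ring]
    · have := hset.orthogonality hfl
      have : 0 ≤ n * (m + n + 1) * u := by positivity
      linarith
    · refine (hset.residual hfl).trans ?_
      have h1 : lRatio X t₁ * norm2 X = maxAbs X * √t₁ := div_mul_cancel₀ _ hN.ne'
      have e : (2.19 + 3.4 * lRatio X t₁) * hFactor m n v * n ^ 2 * u * norm2 X =
          hFactor m n v * (n ^ 2 * u * (2.19 * norm2 X + 3.4 * (lRatio X t₁ * norm2 X))) := by ring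
      rw [e, h1]
      have h2 : 0 ≤ n ^ 2 * u * norm2 X := by positivity
      have h3 : 0 ≤ n ^ 2 * u * (maxAbs X * √t₁) := by positivity
      have h4 := mul_le_mul_of_nonneg_right hh
        (by positivity : 0 ≤ n ^ 2 * u * (2.19 * norm2 X + 3.4 * (maxAbs X * √t₁)))
      -- `1.49 · 2.19 ≥ 3.14` and `1.49 · 3.4 ≥ 2.1`.
      linarith
  · rw [← hrank]
    simpa using X.rank_le_card_height
  · rw [hna]
    rw [hs11, one_div_mul_eq_div, le_div_iff₀ (by positivity)] at hsF
    -- Cancelling `F` from `11 a F ≤ F / (100 n)` is the source of the bound `1/1100`.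
    have h1 : 1100 * (n * a) * F ≤ 1 * F := by linarith
    have := le_of_mul_le_mul_right h1 hF0
    linarith
  · have h1 : 1 / (100 * n) * F ≤ gNorm X ^ 2 / 100 := by
      rw [one_div_mul_eq_div, div_le_iff₀ (by positivity)]
      linarith
    have h2 := pow_le_pow_left₀ (gNorm_nonneg X) (gNorm_le_norm2 hn0 X) 2
    linarith
  · have hl : 0 < lRatio X t₁ := by unfold lRatio; positivity
    rw [kappa2, le_div_iff₀ (by positivity), div_mul_eq_mul_div, div_le_iff₀ hσ] at hcap
    have h1 : lRatio X t₁ * norm2 X = maxAbs X * √t₁ := div_mul_cancel₀ _ hN.ne'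
    have h2 : norm2 X * (4 * n ^ 2 * u * hFactor m n v * lRatio X t₁) =
        hFactor m n v * (4 * (n ^ 2 * u * (lRatio X t₁ * norm2 X))) := by ring
    rw [h2, h1] at hcap
    -- `4 · 1.49 = 5.96`, the constant in `cap`.
    have h4 := mul_le_mul_of_nonneg_right hh
      (by positivity : 0 ≤ 4 * (n ^ 2 * u * (maxAbs X * √t₁)))
    linarith
  · have hε : 0 < 11 * n * (β * K / m) := by
      have : β * K / m = β / m * K := by ring
      rw [this]; positivity
    have hq := Real.sqrt_pos.2 hε
    have hq2 := Real.sq_sqrt hε.le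
    have hh0 : 0 < hFactor m n v := by linarith
    have hau : (m * u + (n + 1) * u : ℝ) = a := by ring
    rw [hau, kappa2, le_div_iff₀ (by positivity), div_mul_eq_mul_div, div_le_iff₀ hσ, one_mul] at hκ
    -- Squaring makes the shift appear: `11 n (βK/m) a² ‖X‖₂² = n a · 11 a F = n a s`, with the
    -- factor `256 h² ≥ 570`.
    have h1 := pow_le_pow_left₀ (by positivity) hκ 2
    have e : (norm2 X * (16 * √(11 * n * (β * K / m)) * a * hFactor m n v)) ^ 2 =
        hFactor m n v ^ 2 * (256 * (n * a * (11 * a * F))) := by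
      rw [hFN, mul_pow, mul_pow, mul_pow, mul_pow, hq2]; ring
    rw [e, ← hs11] at h1
    have hs0 : 0 < s := by rw [hs11]; positivity
    have h4 := mul_le_mul_of_nonneg_right (le_hFactor_sq m n v)
      (by positivity : 0 ≤ 256 * (n * a * s))
    have h5 : 0 ≤ n * a * s := by positivity
    rw [hna]
    linarith
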